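/- **Setting.** Let $n\ge 2$, $m\ge 1$, let $G$ be a connected graph on $\{1,\dots,n\}$, and consider $\min_{x\in\mathbb R^d}\sum_{i=1}^n\big[\frac{\sigma_i}{2}\|x\|^2+\sum_{j=1}^m f_{ij}(x)\big]$ with $\sigma_i>0$ and each $f_{ij}:\mathbb R^d\to\mathbb R$ convex, differentiable and $L_{ij}$-smooth, $L_{ij}>0$. Let $P_{ij}$ be the orthogonal projector on $\mathrm{Ker}(f_{ij})^\perp$, where $\mathrm{Ker}(f_{ij})=\{v: f_{ij}(x+sv)=f_{ij}(x)\ \forall x\in\mathbb R^d,\,s\in\mathbb R\}$ is the space of directions along which $f_{ij}$ is constant. Choose non-zero weights $\mu_{k\ell}$ for the edges of $G$ (communication edges), and let $A_{\rm comm}$ be the matrix whose column for the edge $(k,\ell)$ is $\mu_{k\ell}(u_k-u_\ell)$, $W=A_{\rm comm}A_{\rm comm}^\top$ (the gossip matrix), $\gamma=\lambda_{\min}^+(W)/\lambda_{\max}(W)$, $\Sigma_{\rm comm}=\mathrm{Diag}(\sigma_i^{-1})$, $D_M=\mathrm{Diag}\big(\sigma_i+\lambda_{\max}(\sum_jL_{ij}P_{ij})\big)$,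 where $\lambda^+_{\min}$ is the smallest non-zero eigenvalue. Put $$\alpha=2\lambda_{\min}^+(A_{\rm comm}^\top D_M^{-1}A_{\rm comm}),\quad \kappa_{\rm comm}=\gamma\,\frac{\lambda_{\max}(A_{\rm comm}^\top\Sigma_{\rm comm}A_{\rm comm})}{\lambda_{\min}^+(A_{\rm comm}^\top D_M^{-1}A_{\rm comm})},\quad \kappa_s=\max_i\frac{1+\sum_jL_{ij}}{\sigma_i}$$ (everything below also holds with $\kappa_s=\max_i(1+\sigma_i^{-1}\sum_jL_{ij})$), and $$p_{\rm comm}=\Big(1+\gamma\frac{m+\kappa_s}{\kappa_{\rm comm}}\Big)^{-1},\quad p_{ij}=(1-p_{\rm comm})\frac{1+L_{ij}/\sigma_i}{\sum_{k}(1+L_{ik}/\sigma_i)},\quad p_{\min}=\min\big(p_{\rm comm},\min_{ij}p_{ij}\big),$$ $$\eta_{\max}=\min\Big(\frac{p_{\rm comm}}{\lambda_{\max}(A_{\rm comm}^\top\Sigma_{\rm comm}A_{\rm comm})},\ \min_{ij}\frac{p_{ij}}{\alpha(1+L_{ij}/\sigma_i)}\Big).$$ **Dual problem.** Let $\mu_{ij}=\sqrt{\alpha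 L_{ij}}$. For $\lambda=(x,y)$, with one vector $x^{(e)}\in\mathbb R^d$ for each communication edge and $y^{(ij)}\in\mathbb R^d$ for each $i,j$, let $(A\lambda)^{(i)}=((A_{\rm comm}\otimes I_d)x)^{(i)}-\sum_j\mu_{ij}P_{ij}y^{(ij)}$ and $(A\lambda)^{(ij)}=\mu_{ij}P_{ij}y^{(ij)}$. Let $q_A(\lambda)=\frac12\sum_i\sigma_i^{-1}\|(A\lambda)^{(i)}\|^2$, $f^*_{\rm sum}(\lambda)=\sum_{ij}f_{ij}^*((A\lambda)^{(ij)})$, where $f_{ij}^*$ is the Fenchel conjugate, $D=-(q_A+f_{\rm sum}^*)$, and let $\lambda_\star$ be any maximizer of $D$. Let $\phi(\lambda)=\frac12\|x\|^2_{A^\dagger A}+\sum_{ij}\frac{L_{ij}}{\mu_{ij}^2}f_{ij}^*((A\lambda)^{(ij)})$. **Algorithm (DVR).** Fix a step size $0<\eta\le\eta_{\max}$. Start from arbitrary $x_0$ and $z_0=(z_0^{(ij)})$, and let $\theta_0^{(i)}=\sigma_i^{-1}(A\lambda_0)^{(i)}$, where throughout $\lambda_t=(x_t,y_t)$ with $y_t^{(ij)}=\mu_{ij}^{-1}\nabla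 f_{ij}(z_t^{(ij)})$. At each iteration, independently of the past: with probability $p_{\rm comm}$, $\theta_{t+1}=\theta_t-\frac{\eta}{p_{\rm comm}}\Sigma_{\rm comm}W\theta_t$, $x_{t+1}=x_t-\frac{\eta}{p_{\rm comm}}\nabla_xq_A(\lambda_t)$ and $z_{t+1}=z_t$; otherwise, $x_{t+1}=x_t$ and each node $i$ independently picks one $j$ with probability $p_{ij}/(1-p_{\rm comm})$ and sets $z_{t+1}^{(ij)}=(1-\frac{\alpha\eta}{p_{ij}})z_t^{(ij)}+\frac{\alpha\eta}{p_{ij}}\theta_t^{(i)}$ and $\theta_{t+1}^{(i)}=\theta_t^{(i)}-\sigma_i^{-1}\big(\nabla f_{ij}(z_{t+1}^{(ij)})-\nabla f_{ij}(z_t^{(ij)})\big)$, its other $z^{(ij')}$ being unchanged. A communication takes time $\tau\ge0$, a computation step takes time $1$. Let $D_\phi(\lambda_\star,\lambda_t)=\phi(\lambda_\star)-\phi(\lambda_t)-\langle g_t,\lambda_\star-\lambda_t\rangle$, where $g_t$ is the (sub)gradient of $\phi$ at $\lambda_t$ given by $A^\dagger A(x_t,0)$ in the communication coordinates and $\frac{L_{ij}}{\mu_{ij}}P_{ij}z_t^{(ij)}$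 in the coordinates $(ij)$ (so $z_t^{(ij)}\in\partial f^*_{ij}(\mu_{ij}y_t^{(ij)})$ stands for $\nabla f_{ij}^*(\mu_{ij}y_t^{(ij)})$), and let $$\mathcal L_t=\frac{p_{\min}}{\eta}D_\phi(\lambda_\star,\lambda_t)+D(\lambda_\star)-D(\lambda_t).$$ **Theorem.** $\eta_{\max}>0$, and for every $0<\eta\le\eta_{\max}$: $0<1-\frac{\alpha\eta}{2}<1$; the values $D(\lambda_\star),D(\lambda_t),\phi(\lambda_\star),\phi(\lambda_t)$ are finite and $g_t\in\partial\phi(\lambda_t)$; $\theta_t^{(i)}=\sigma_i^{-1}(A\lambda_t)^{(i)}$ for all $t$ and $i$; and for all $t\ge0$ $$\mathbb E[\mathcal L_{t+1}\mid\text{state at time }t]\le\Big(1-\frac{\alpha\eta}{2}\Big)\mathcal L_t,\qquad\text{hence}\qquad \mathbb E[\mathcal L_t]\le\Big(1-\frac{\alpha\eta}{2}\Big)^t\mathcal L_0 .$$ Moreover, for $\eta=\eta_{\max}$, the expected time $T_\varepsilon$ required to reach precision $\varepsilon$, that is, the expected duration of the first $K_\varepsilon$ iterations, where $K_\varepsilon$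 is the smallest $K$ such that $\mathbb E[\mathcal L_t]\le\varepsilon$ for all $t\ge K$, satisfies $$T_\varepsilon=O\Big(\Big[2(m+\kappa_s)+\tau\frac{\kappa_{\rm comm}}{\gamma}\Big]\log\varepsilon^{-1}\Big)$$ with an absolute constant: $T_\varepsilon\le4\big[2(m+\kappa_s)+\tau\kappa_{\rm comm}/\gamma\big]\log\varepsilon^{-1}$ whenever $0<\varepsilon\le e^{-1}/(1+\mathcal L_0)$. -/

import Mathlib

open MeasureTheory ProbabilityTheory

noncomputable section

namespace DVR

/-- The parameter space `ℝ^d`. -/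
abbrev Vec (d : ℕ) := EuclideanSpace ℝ (Fin d)

/-- The edges of a graph on `Fin n`, each listed once, oriented from the smaller to the larger
end point. -/
abbrev Edge {n : ℕ} (G : SimpleGraph (Fin n)) :=
  {e : Fin n × Fin n // e.1 < e.2 ∧ G.Adj e.1 e.2}

instance instFintypeEdge {n : ℕ} (G : SimpleGraph (Fin n)) : Fintype (Edge G) :=
  Fintype.ofFinite _

/-- Largest spectral value (largest eigenvalue of a symmetric matrix or operator). -/
def lamMax {R : Type*} [Ring R] [Algebra ℝ R] (a : R) : ℝ := sSup (spectrum ℝ a)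

/-- Smallest non-zero spectral value (used for positive semi-definite matrices). -/
def lamMinPos {R : Type*} [Ring R] [Algebra ℝ R] (a : R) : ℝ := sInf {r ∈ spectrum ℝ a | r ≠ 0}

/-- `Ker(f)`: the subspace of the directions along which `f` is constant. -/
def flatSpace {d : ℕ} (f : Vec d → ℝ) : Submodule ℝ (Vec d) where
  carrier := {v | ∀ (x : Vec d) (s : ℝ), f (x + s • v) = f x}
  add_mem' := by
    intro a b ha hb x s
    rw [smul_add, ← add_assoc, hb, ha]
  zero_mem' := by
    intro x s
    simp
  smul_mem' := by
    intro c v hv x s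
    rw [smul_smul, hv]

/-- If the `C²` function `f` is constant along every direction that lies in the kernels of all its
Hessians, then `flatSpace f` is the intersection of these kernels. -/
theorem mem_flatSpace_iff_hessian {d : ℕ} (f : Vec d → ℝ)
    (hf : ContDiff ℝ 2 f)
    (hconst : ∀ v, (∀ x, fderiv ℝ (gradient f) x v = 0) → ∀ (x : Vec d) (s : ℝ), f (x + s • v) = f x)
    (v : Vec d) : v ∈ flatSpace f ↔ ∀ x, fderiv ℝ (gradient f) x v = 0 := by
  refine ⟨fun hv x => ?_, hconst v⟩
  have hg : Differentiable ℝ (gradient f) := by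
    have h1 : Differentiable ℝ (fderiv ℝ f) :=
      (hf.fderiv_right (m := 1) (by norm_num)).differentiable (by norm_num)
    exact (InnerProductSpace.toDual ℝ (Vec d)).symm.toContinuousLinearEquiv.differentiable.comp h1
  have hinv : ∀ s : ℝ, gradient f (x + s • v) = gradient f x := by
    intro s
    have h2 : (fun y => f (y + s • v)) = f := funext fun y => hv y s
    have h3 : fderiv ℝ f (x + s • v) = fderiv ℝ f x := by
      rw [← fderiv_comp_add_right, h2]
    simp only [gradient, h3]
  have h4 : HasDerivAt (fun s : ℝ => gradient f (x + s • v)) (fderiv ℝ (gradient f) x v) 0 := by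
    have h5 : HasDerivAt (fun s : ℝ => x + s • v) v 0 := by
      simpa using ((hasDerivAt_id (0 : ℝ)).smul_const v).const_add x
    have h6 : HasFDerivAt (gradient f) (fderiv ℝ (gradient f) x) (x + (0 : ℝ) • v) := by
      simpa using (hg x).hasFDerivAt
    exact h6.comp_hasDerivAt 0 h5
  rw [funext hinv] at h4
  exact h4.unique (hasDerivAt_const 0 _)

/-- The Fenchel conjugate `f^*(u) = sup_v ⟨u, v⟩ - f(v)`, with values in `[-∞, ∞]`. -/
def fenchel {d : ℕ} (f : Vec d → ℝ) (u : Vec d) : EReal :=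
  ⨆ v : Vec d, ((inner ℝ u v - f v : ℝ) : EReal)

/-- The data of the decentralized finite-sum problem
`min_x ∑ i, (σ i / 2 * ‖x‖² + ∑ j, f i j x)`: local losses `f i j` with smoothness constants `L i j`,
local regularizations `σ i`, the communication graph `G`, and the weights `w e = μ_{kℓ}` of its
edges in the dual formulation. -/
structure Problem (n m d : ℕ) where
  f : Fin n → Fin m → Vec d → ℝ
  L : Fin n → Fin m → ℝ
  σ : Fin n → ℝ
  G : SimpleGraph (Fin n)
  w : Edge G → ℝ

/-- The outcome of the sampling at one iteration: either a communication step, or a computation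
step in which node `i` samples the component `J i`. -/
inductive Draw (n m : ℕ) : Type
  | comm : Draw n m
  | comp (J : Fin n → Fin m) : Draw n m

namespace Draw

/-- A draw is either `comm` or a choice function. -/
def equivOption (n m : ℕ) : Option (Fin n → Fin m) ≃ Draw n m where
  toFun o := match o with
    | none => comm
    | some J => comp J
  invFun e := match e with
    | comm => none
    | comp J => some J
  left_inv o := by cases o <;> rfl
  right_inv e := by cases e <;> rfl

instance instFintypeDraw (n m : ℕ) : Fintype (Draw n m) := Fintype.ofEquiv _ (equivOption n m)

instance instMeasurableSpaceDraw (n m : ℕ) : MeasurableSpace (Draw n m) := ⊤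

/-- The duration of an iteration: `τ` for a communication, `1` for a computation (all nodes compute
their stochastic gradient in parallel). -/
def cost {n m : ℕ} (τ : ℝ) : Draw n m → ℝ
  | comm => τ
  | comp _ => 1

end Draw

namespace Problem

variable {n m d : ℕ} (P : Problem n m d)

/-- The projector `P_{ij}` on `Ker(f_{ij})^⊥`. -/
def proj (i : Fin n) (j : Fin m) : Vec d →L[ℝ] Vec d := (flatSpace (P.f i j))ᗮ.starProjection

/-- The matrix `A_comm` (without the factor `⊗ I_d`, which does not change the spectra below):
column `e = (k, ℓ)` is `μ_{kℓ} (u_k - u_ℓ)`. -/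
def aComm : Matrix (Fin n) (Edge P.G) ℝ :=
  Matrix.of fun k e => P.w e * ((if k = e.1.1 then 1 else 0) - (if k = e.1.2 then 1 else 0))

/-- The gossip matrix `W = A_comm A_commᵀ`. -/
def gossip : Matrix (Fin n) (Fin n) ℝ := P.aComm * P.aComm.transpose

/-- The spectral gap `γ` of the gossip matrix. -/
def gap : ℝ := lamMinPos P.gossip / lamMax P.gossip

/-- `Σ_comm = Diag(1 / σ_i)`. -/
def sigmaComm : Matrix (Fin n) (Fin n) ℝ := Matrix.diagonal fun i => (P.σ i)⁻¹

/-- `D_M = Diag(σ_i + λ_max(∑_j L_{ij} P_{ij}))`. -/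
def dM : Matrix (Fin n) (Fin n) ℝ :=
  Matrix.diagonal fun i => P.σ i + lamMax (∑ j, P.L i j • P.proj i j)

/-- `λ_max(A_commᵀ Σ_comm A_comm)`. -/
def commSmooth : ℝ := lamMax (P.aComm.transpose * P.sigmaComm * P.aComm)

/-- `λ_min⁺(A_commᵀ D_M⁻¹ A_comm)`. -/
def commConvex : ℝ := lamMinPos (P.aComm.transpose * P.dM⁻¹ * P.aComm)

/-- `α = 2 λ_min⁺(A_commᵀ D_M⁻¹ A_comm)`. -/
def alpha : ℝ := 2 * P.commConvex

/-- `κ_comm = γ λ_max(A_commᵀ Σ_comm A_comm) / λ_min⁺(A_commᵀ D_M⁻¹ A_comm)`. -/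
def kappaComm : ℝ := P.gap * P.commSmooth / P.commConvex

/-- `p_comm = (1 + γ (m + κ_s) / κ_comm)⁻¹`. -/
def pComm (κs : ℝ) : ℝ := (1 + P.gap * ((m + κs) / P.kappaComm))⁻¹

/-- `p_{ij}`, proportional (in `j`) to `(1 - p_comm) (1 + L_{ij} / σ_i)`, with
`∑_j p_{ij} = 1 - p_comm`. -/
def pComp (κs : ℝ) (i : Fin n) (j : Fin m) : ℝ :=
  (1 - P.pComm κs) * (1 + P.L i j / P.σ i) / ∑ k, (1 + P.L i k / P.σ i)

/-- `p_min = min(p_comm, min_{ij} p_{ij})`. -/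
def pMin (κs : ℝ) : ℝ :=
  min (P.pComm κs) (⨅ ij : Fin n × Fin m, P.pComp κs ij.1 ij.2)

/-- The step size of the algorithm. -/
def stepSize (κs : ℝ) : ℝ :=
  min (P.pComm κs / P.commSmooth)
    (⨅ ij : Fin n × Fin m, P.pComp κs ij.1 ij.2 / (P.alpha * (1 + P.L ij.1 ij.2 / P.σ ij.1)))

/-- The weight `μ_{ij}` of a virtual edge, `μ_{ij}² = α L_{ij}`. -/
def mu (i : Fin n) (j : Fin m) : ℝ := √(P.alpha * P.L i j)

/-- Dual variables `λ = (x, y)`: one vector for each communication edge and each virtual edge. -/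
abbrev DualVar := PiLp 2 fun _ : Edge P.G ⊕ (Fin n × Fin m) => Vec d

/-- One vector for each node of the augmented graph: the nodes `i` and the virtual
nodes `(i, j)`. -/
abbrev NodeVar (_ : Problem n m d) := PiLp 2 fun _ : Fin n ⊕ (Fin n × Fin m) => Vec d

/-- The matrix `A`: the column of a communication edge is `μ_{kℓ} (u_k - u_ℓ) ⊗ I_d`, the one of a
virtual edge is `μ_{ij} (u_{ij} - u_i) ⊗ P_{ij}`. -/
def augA : P.DualVar →ₗ[ℝ] P.NodeVar where
  toFun lam := WithLp.toLp 2 (Sum.elim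
    (fun i => ∑ e, P.aComm i e • lam (Sum.inl e) - ∑ j, P.mu i j • P.proj i j (lam (Sum.inr (i, j))))
    (fun ij => P.mu ij.1 ij.2 • P.proj ij.1 ij.2 (lam (Sum.inr ij))))
  map_add' a b := by
    ext k : 1
    rcases k with i | ij
    · simp only [PiLp.add_apply, Sum.elim_inl, smul_add, map_add, Finset.sum_add_distrib]
      abel
    · simp only [PiLp.add_apply, Sum.elim_inr, smul_add, map_add]
  map_smul' c a := by
    ext k : 1
    rcases k with i | ij
    · simp only [PiLp.smul_apply, Sum.elim_inl, map_smul, smul_comm _ c, RingHom.id_apply,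
        smul_sub, Finset.smul_sum]
    · simp only [PiLp.smul_apply, Sum.elim_inr, map_smul, smul_comm _ c, RingHom.id_apply]

/-- `A† A`, the orthogonal projector on `(ker A)^⊥`. -/
def pinvA : P.DualVar →L[ℝ] P.DualVar := (LinearMap.ker P.augA)ᗮ.starProjection

/-- `(x, y) ↦ (x, 0)`. -/
def commPart (lam : P.DualVar) : P.DualVar :=
  WithLp.toLp 2 (Sum.elim (fun e => lam (Sum.inl e)) (fun _ => 0))

/-- `q_A(λ) = ½ λᵀ Aᵀ Σ A λ`. -/
def qA (lam : P.DualVar) : ℝ :=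
  1 / 2 * ∑ i, (P.σ i)⁻¹ * ‖P.augA lam (Sum.inl i)‖ ^ 2

/-- `f_sum^*(λ) = ∑_{ij} f_{ij}^*((A λ)^{(ij)})`. -/
def fSumConj (lam : P.DualVar) : EReal :=
  ∑ i, ∑ j, fenchel (P.f i j) (P.augA lam (Sum.inr (i, j)))

/-- The dual objective `D = -(q_A + f_sum^*)`. -/
def dualObj (lam : P.DualVar) : EReal := -((P.qA lam : EReal) + P.fSumConj lam)

/-- The reference function `φ(x, y) = ½ ‖x‖²_{A† A} + ∑_{ij} L_{ij} / μ_{ij}² f_{ij}^*(μ_{ij} y^{(ij)})`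
(with `P_{ij} y^{(ij)}` for `y^{(ij)}`, so that it depends on `A λ` only, as `D` does). -/
def phi (lam : P.DualVar) : EReal :=
  ((1 / 2 * inner ℝ (P.commPart lam) (P.pinvA (P.commPart lam)) : ℝ) : EReal) +
    ∑ i, ∑ j, ((P.L i j / P.mu i j ^ 2 : ℝ) : EReal) *
      fenchel (P.f i j) (P.augA lam (Sum.inr (i, j)))

/-- The Bregman divergence `φ(a) - φ(b) - ⟨g, a - b⟩` of `φ`, where `g` is the (sub)gradient of `φ`
at `b` (used where `φ(a)` and `φ(b)` are finite). -/
def bregman (g a b : P.DualVar) : ℝ :=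
  (P.phi a).toReal - (P.phi b).toReal - inner ℝ g (a - b)

/-- The state of the algorithm: the node parameters `θ^{(i)}`, the virtual parameters `z^{(ij)}`, and
the dual variables `x` of the communication edges (on which `θ` and `z` do not depend). -/
structure State where
  x : Edge P.G → Vec d
  θ : Fin n → Vec d
  z : Fin n → Fin m → Vec d

/-- The dual point `λ = (x, y)` with `y^{(ij)} = ∇f_{ij}(z^{(ij)}) / μ_{ij}`. -/
def dualPoint (x : Edge P.G → Vec d) (z : Fin n → Fin m → Vec d) : P.DualVar :=
  WithLp.toLp 2 (Sum.elim x
    (fun ij => (P.mu ij.1 ij.2)⁻¹ • gradient (P.f ij.1 ij.2) (z ij.1 ij.2)))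

variable {P} in
/-- The dual iterate that a state carries. -/
def State.lam (s : P.State) : P.DualVar := P.dualPoint s.x s.z

variable {P} in
/-- The gradient of `φ` at the dual iterate, where the role of `∇f_{ij}^*(μ_{ij} y^{(ij)})` is played
by the vector `z^{(ij)} ∈ ∂f_{ij}^*(μ_{ij} y^{(ij)})` that the algorithm maintains. -/
def State.gradPhi (s : P.State) : P.DualVar :=
  P.pinvA (P.commPart s.lam) +
    WithLp.toLp 2 (Sum.elim (fun _ => 0)
      (fun ij => (P.L ij.1 ij.2 / P.mu ij.1 ij.2 ^ 2) •
        P.mu ij.1 ij.2 • P.proj ij.1 ij.2 (s.z ij.1 ij.2)))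

/-- Initial state: `x₀` and `z₀` are arbitrary and `θ₀ = Σ A λ₀`. For `x₀ = 0` this is
`θ₀^{(i)} = -(∑_j ∇f_{ij}(z₀^{(ij)})) / σ_i`. -/
def init (x₀ : Edge P.G → Vec d) (z₀ : Fin n → Fin m → Vec d) : P.State where
  x := x₀
  θ := fun i => (P.σ i)⁻¹ • P.augA (P.dualPoint x₀ z₀) (Sum.inl i)
  z := z₀

/-- One iteration of DVR with step size `η`. -/
def step (κs η : ℝ) (s : P.State) : Draw n m → P.State
  | Draw.comm =>
    { x := fun e => s.x e - (η / P.pComm κs) • gradient P.qA s.lam (Sum.inl e)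
      θ := fun i => s.θ i - (η / P.pComm κs) • (P.σ i)⁻¹ • ∑ k, P.gossip i k • s.θ k
      z := s.z }
  | Draw.comp J =>
    let znew : Fin n → Vec d := fun i =>
      (1 - P.alpha * η / P.pComp κs i (J i)) • s.z i (J i) +
        (P.alpha * η / P.pComp κs i (J i)) • s.θ i
    { x := s.x
      θ := fun i => s.θ i - (P.σ i)⁻¹ •
        (gradient (P.f i (J i)) (znew i) - gradient (P.f i (J i)) (s.z i (J i)))
      z := fun i j => if j = J i then znew i else s.z i j }

/-- The state after `t` iterations with the draws `e 0, e 1, …`. -/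
def run (κs η : ℝ) (s₀ : P.State) (e : ℕ → Draw n m) : ℕ → P.State
  | 0 => s₀
  | t + 1 => P.step κs η (run κs η s₀ e t) (e t)

/-- The sampling law: communication with probability `p_comm`; otherwise each node `i` independently
picks `j` with (conditional) probability `p_{ij} / (1 - p_comm)`. -/
def drawProb (κs : ℝ) : Draw n m → ℝ
  | Draw.comm => P.pComm κs
  | Draw.comp J => (1 - P.pComm κs) * ∏ i, P.pComp κs i (J i) / (1 - P.pComm κs)

/-- The dual Lyapunov quantity `(p_min / η) D_φ(λ⋆, λ) + D(λ⋆) - D(λ)`. -/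
def lyapunov (κs η : ℝ) (lamStar : P.DualVar) (s : P.State) : ℝ :=
  P.pMin κs / η * P.bregman s.gradPhi lamStar s.lam +
    ((P.dualObj lamStar).toReal - (P.dualObj s.lam).toReal)

end Problem

end DVR

end

/-!
The iterates of DVR are those of a randomized Bregman coordinate descent on the dual cost
`F = q_A + f_sum^*`, with the mirror map `φ` and with the communication coordinates as one block and
each virtual edge `(i, j)` as another. By `augA_lam_inr`, `(A λ)^{(ij)} = ∇f_{ij}(z^{(ij)})`, so `z^{(ij)}`
is a subgradient of `f_{ij}^*` at `(A λ)^{(ij)}` and every divergence below is explicit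
(`bregman_eq`, `lyapunov_eq`).

*One step.* For each block `b`, `F` is smooth relative to `φ`, with the constant
`λ_max(A_commᵀ Σ_comm A_comm)` for the communications and `α (1 + L_{ij} / σ_i)` for `(i, j)`; the step
size is at most `p_b` over this constant. The three-point identity of a mirror step then bounds the
change of the Lyapunov quantity by `p_min / p_b` times the linear term `⟨∇_b F(λ), λ⋆ - λ⟩`
(`lyapunov_step_comm_le`, `lyapunov_step_comp_le`). The nodes updated in one computation step do not
interact, because `q_A` is a sum over the nodes. In expectation the linear terms add up to
`p_min ⟨∇F(λ), λ⋆ - λ⟩` (`sum_linear_terms`).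

*Relative strong convexity.* It remains to see that
`F(λ) - F(λ⋆) + D_F(λ⋆, λ) ≥ (α / 2) D_φ(λ⋆, λ) + t (F(λ) - F(λ⋆))` with `t = α η / (2 p_min)`.
The conjugates being `1 / L_{ij}`-strongly convex, both `D_F(λ⋆, λ)` and the dual gap are bounded
below by quadratic forms (`le_conjDiv`, `qA_add_gradDist_le`). Since only half of the curvature of
`f_sum^*` is left once its share of `α φ / 2` is removed, the bound for `D_F(λ⋆, λ)` alone is too weak,
and the part `1 - t` of the dual gap has to be used (`commConvex_mul_norm_sq_le`). This is
enough when `t ≤ 1 / 2`. Otherwise `p_min = p_comm`, so that `t` is at most the inverse relative condition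
number of the communication block (`ratio_dichotomy`); a tangent line to a convex function at `t`
(`tangent_coef_le`) then combines the upper and the lower spectral bound for `A_comm`.

*Process and time.* The contraction integrates over independent draws (`integral_next_le`), and the
duration follows from a lower bound on the rate at the largest step size
(`inv_le_commConvex_mul_stepSize`).
-/

/-! ### Rayleigh bounds for the extreme spectral values -/

namespace DVR

section Rayleigh

variable {E : Type*} [NormedAddCommGroup E] [InnerProductSpace ℝ E] [FiniteDimensional ℝ E]

theorem inner_map_self_eq_sum_eigenvalues {T : Module.End ℝ E} (hT : T.IsSymmetric) (v : E) :
    inner ℝ (T v) v =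
      ∑ k, hT.eigenvalues rfl k * inner ℝ (hT.eigenvectorBasis rfl k) v ^ 2 := by
  rw [← (hT.eigenvectorBasis rfl).sum_inner_mul_inner]
  refine Finset.sum_congr rfl fun k _ => ?_
  rw [hT, hT.apply_eigenvectorBasis, real_inner_comm, RCLike.ofReal_real_eq_id, id, inner_smul_left,
    RCLike.conj_to_real]
  ring

theorem eigenvalues_mem_spectrum {T : Module.End ℝ E} (hT : T.IsSymmetric)
    (k : Fin (Module.finrank ℝ E)) : hT.eigenvalues rfl k ∈ spectrum ℝ T :=
  (hT.hasEigenvalue_eigenvalues rfl k).mem_spectrum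

theorem inner_map_self_le_lamMax {T : Module.End ℝ E} (hT : T.IsSymmetric) (v : E) :
    inner ℝ (T v) v ≤ lamMax T * ‖v‖ ^ 2 := by
  rw [inner_map_self_eq_sum_eigenvalues hT, ← (hT.eigenvectorBasis rfl).sum_sq_inner_right v,
    Finset.mul_sum]
  refine Finset.sum_le_sum fun k _ => mul_le_mul_of_nonneg_right ?_ (sq_nonneg _)
  exact le_csSup (Module.End.finite_spectrum T).bddAbove (eigenvalues_mem_spectrum hT k)

/-- On the orthogonal complement of its kernel, a symmetric map is bounded below by its smallest
non-zero eigenvalue. -/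
theorem lamMinPos_le_inner_map_self {T : Module.End ℝ E} (hT : T.IsSymmetric) {v : E}
    (hv : ∀ u, T u = 0 → inner ℝ u v = 0) : lamMinPos T * ‖v‖ ^ 2 ≤ inner ℝ (T v) v := by
  rw [inner_map_self_eq_sum_eigenvalues hT, ← (hT.eigenvectorBasis rfl).sum_sq_inner_right v,
    Finset.mul_sum]
  refine Finset.sum_le_sum fun k _ => ?_
  by_cases h0 : hT.eigenvalues rfl k = 0
  · have h1 : T (hT.eigenvectorBasis rfl k) = 0 := by
      rw [hT.apply_eigenvectorBasis, h0]; simp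
    rw [hv _ h1]; simp
  · refine mul_le_mul_of_nonneg_right ?_ (sq_nonneg _)
    exact csInf_le ((Module.End.finite_spectrum T).subset fun _ h => h.1).bddBelow
      ⟨eigenvalues_mem_spectrum hT k, h0⟩

theorem lamMinPos_pos {T : Module.End ℝ E} (hT : T.IsSymmetric)
    (hpos : ∀ v, 0 ≤ inner ℝ (T v) v) (h0 : T ≠ 0) : 0 < lamMinPos T := by
  have hfin : {r ∈ spectrum ℝ T | r ≠ 0}.Finite :=
    (Module.End.finite_spectrum T).subset fun _ h => h.1
  have hne : {r ∈ spectrum ℝ T | r ≠ 0}.Nonempty := by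
    by_contra hemp
    apply h0
    rw [← hT.inner_map_self_eq_zero]
    intro v
    rw [inner_map_self_eq_sum_eigenvalues hT]
    refine Finset.sum_eq_zero fun k _ => ?_
    have h1 : hT.eigenvalues rfl k = 0 := by
      by_contra h2
      exact hemp ⟨_, eigenvalues_mem_spectrum hT k, h2⟩
    rw [h1, zero_mul]
  obtain ⟨h1, h2⟩ := hne.csInf_mem hfin
  refine lt_of_le_of_ne ?_ (Ne.symm h2)
  obtain ⟨v, hv⟩ := (Module.End.hasEigenvalue_iff_mem_spectrum.mpr h1).exists_hasEigenvector
  have h3 := hpos v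
  rw [hv.apply_eq_smul, real_inner_smul_left, real_inner_self_eq_norm_sq] at h3
  have h4 : 0 < ‖v‖ ^ 2 := by have := norm_pos_iff.mpr hv.2; positivity
  exact nonneg_of_mul_nonneg_left h3 h4

theorem lamMax_pos {T : Module.End ℝ E} (hT : T.IsSymmetric)
    (hpos : ∀ v, 0 ≤ inner ℝ (T v) v) (h0 : T ≠ 0) : 0 < lamMax T := by
  by_contra! h
  apply h0
  rw [← hT.inner_map_self_eq_zero]
  intro v
  exact le_antisymm ((inner_map_self_le_lamMax hT v).trans
    (mul_nonpos_of_nonpos_of_nonneg h (sq_nonneg _))) (hpos v)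

theorem lamMax_continuousLinearMap (T : E →L[ℝ] E) : lamMax T = lamMax (T : Module.End ℝ E) := by
  have h := AlgEquiv.spectrum_eq (Module.End.toContinuousLinearMap E (𝕜 := ℝ)) (T : Module.End ℝ E)
  unfold lamMax
  rw [← h]
  rfl

end Rayleigh

section Matrix

open scoped Matrix

theorem norm_toLp_sq_eq_dotProduct {ι : Type*} [Fintype ι] (v : ι → ℝ) :
    ‖WithLp.toLp 2 v‖ ^ 2 = v ⬝ᵥ v := by
  rw [EuclideanSpace.norm_sq_eq]; simp [dotProduct, sq]

variable {ι : Type*} [Fintype ι] [DecidableEq ι]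

theorem lamMax_matrix (M : Matrix ι ι ℝ) :
    lamMax M = lamMax (R := Module.End ℝ (EuclideanSpace ℝ ι)) (Matrix.toLpLin 2 2 M) := by
  unfold lamMax; rw [Matrix.spectrum_toLpLin]

theorem lamMinPos_matrix (M : Matrix ι ι ℝ) :
    lamMinPos M = lamMinPos (R := Module.End ℝ (EuclideanSpace ℝ ι)) (Matrix.toLpLin 2 2 M) := by
  unfold lamMinPos; rw [Matrix.spectrum_toLpLin]

theorem inner_toLpLin (M : Matrix ι ι ℝ) (v : EuclideanSpace ℝ ι) :
    inner ℝ (Matrix.toLpLin 2 2 M v) v = v.ofLp ⬝ᵥ (M *ᵥ v.ofLp) := by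
  rw [EuclideanSpace.inner_eq_star_dotProduct]; simp

theorem _root_.Matrix.IsSymm.toLpLin_isSymmetric {M : Matrix ι ι ℝ} (hM : M.IsSymm) :
    (Matrix.toLpLin 2 2 M).IsSymmetric :=
  Matrix.isSymmetric_toEuclideanLin_iff.mpr (by
    rw [Matrix.IsHermitian, Matrix.conjTranspose_eq_transpose_of_trivial]; exact hM)

theorem dotProduct_mulVec_le_lamMax {M : Matrix ι ι ℝ} (hM : M.IsSymm) (v : ι → ℝ) :
    v ⬝ᵥ (M *ᵥ v) ≤ lamMax M * (v ⬝ᵥ v) := by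
  have h := inner_map_self_le_lamMax (Matrix.IsSymm.toLpLin_isSymmetric hM) (WithLp.toLp 2 v)
  rwa [inner_toLpLin, norm_toLp_sq_eq_dotProduct, ← lamMax_matrix] at h

theorem lamMinPos_le_dotProduct_mulVec {M : Matrix ι ι ℝ} (hM : M.IsSymm) {v : ι → ℝ}
    (hv : ∀ u, M *ᵥ u = 0 → u ⬝ᵥ v = 0) : lamMinPos M * (v ⬝ᵥ v) ≤ v ⬝ᵥ (M *ᵥ v) := by
  have h := lamMinPos_le_inner_map_self (Matrix.IsSymm.toLpLin_isSymmetric hM)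
    (v := WithLp.toLp 2 v) fun u hu => by
      have := hv u.ofLp (by simpa [Matrix.toLpLin_apply] using hu)
      rw [EuclideanSpace.inner_eq_star_dotProduct]
      simpa [dotProduct_comm] using this
  rwa [inner_toLpLin, norm_toLp_sq_eq_dotProduct, ← lamMinPos_matrix] at h

theorem lamMinPos_pos_of_matrix {M : Matrix ι ι ℝ} (hM : M.IsSymm)
    (hpos : ∀ v, 0 ≤ v ⬝ᵥ (M *ᵥ v)) (h0 : M ≠ 0) : 0 < lamMinPos M := by
  rw [lamMinPos_matrix]
  exact lamMinPos_pos (Matrix.IsSymm.toLpLin_isSymmetric hM)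
    (fun v => by rw [inner_toLpLin]; exact hpos _) (by simpa using h0)

theorem lamMax_pos_of_matrix {M : Matrix ι ι ℝ} (hM : M.IsSymm)
    (hpos : ∀ v, 0 ≤ v ⬝ᵥ (M *ᵥ v)) (h0 : M ≠ 0) : 0 < lamMax M := by
  rw [lamMax_matrix]
  exact lamMax_pos (Matrix.IsSymm.toLpLin_isSymmetric hM)
    (fun v => by rw [inner_toLpLin]; exact hpos _) (by simpa using h0)

end Matrix

end DVR

/-! ### Smooth convex functions and their Fenchel conjugates -/

namespace DVR

section Conjugate

variable {d : ℕ} {f : Vec d → ℝ} {L : ℝ}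

theorem hasDerivAt_comp_line (hdiff : Differentiable ℝ f) (x h : Vec d) (s : ℝ) :
    HasDerivAt (fun s : ℝ => f (x + s • h)) (inner ℝ (gradient f (x + s • h)) h) s := by
  have h1 : HasDerivAt (fun s : ℝ => x + s • h) h s := by
    simpa using ((hasDerivAt_id s).smul_const h).const_add x
  have h2 := (hdiff (x + s • h)).hasGradientAt.hasFDerivAt.comp_hasDerivAt s h1
  rwa [InnerProductSpace.toDual_apply_apply] at h2

/-- The quadratic upper bound satisfied by a function with `L`-Lipschitz gradient. -/
theorem apply_add_le_of_smooth (hdiff : Differentiable ℝ f)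
    (hsmooth : ∀ u v, ‖gradient f u - gradient f v‖ ≤ L * ‖u - v‖) (x h : Vec d) :
    f (x + h) ≤ f x + inner ℝ (gradient f x) h + L / 2 * ‖h‖ ^ 2 := by
  let F : ℝ → ℝ := fun s => f (x + s • h) - s * inner ℝ (gradient f x) h - L / 2 * s ^ 2 * ‖h‖ ^ 2
  have hF : ∀ s, HasDerivAt F (inner ℝ (gradient f (x + s • h)) h - inner ℝ (gradient f x) h
      - L * s * ‖h‖ ^ 2) s := by
    intro s
    have h1 := hasDerivAt_comp_line hdiff x h s
    have h2 := (hasDerivAt_id s).mul_const (inner ℝ (gradient f x) h)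
    have h3 := (((hasDerivAt_id s).pow 2).const_mul (L / 2)).mul_const (‖h‖ ^ 2)
    refine ((h1.sub h2).sub h3).congr_deriv ?_
    simp only [id, one_mul, mul_one, Nat.cast_ofNat, Nat.add_one_sub_one, pow_one]; ring
  have hanti : AntitoneOn F (Set.Icc 0 1) := by
    apply antitoneOn_of_deriv_nonpos (convex_Icc 0 1)
    · exact fun s _ => (hF s).continuousAt.continuousWithinAt
    · exact fun s _ => (hF s).differentiableAt.differentiableWithinAt
    · intro s hs
      rw [interior_Icc] at hs
      rw [(hF s).deriv, ← inner_sub_left]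
      have h1 := real_inner_le_norm (gradient f (x + s • h) - gradient f x) h
      have h2 := hsmooth (x + s • h) x
      rw [add_sub_cancel_left, norm_smul, Real.norm_eq_abs, abs_of_pos hs.1] at h2
      nlinarith [mul_le_mul_of_nonneg_right h2 (norm_nonneg h)]
  have h01 := hanti (Set.left_mem_Icc.mpr zero_le_one) (Set.right_mem_Icc.mpr zero_le_one) zero_le_one
  simp only [F, one_smul, zero_smul, add_zero] at h01
  linarith

theorem gradient_inequality (hconv : ConvexOn ℝ Set.univ f) (hdiff : Differentiable ℝ f)
    (x y : Vec d) : f x + inner ℝ (gradient f x) (y - x) ≤ f y := by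
  have hc : ConvexOn ℝ Set.univ (fun s : ℝ => f (x + s • (y - x))) := by
    refine ⟨convex_univ, fun a _ b _ p q hp hq hpq => ?_⟩
    have := hconv.2 (Set.mem_univ (x + a • (y - x))) (Set.mem_univ (x + b • (y - x))) hp hq hpq
    convert this using 2
    have hq' : q = 1 - p := by linarith
    subst hq'
    simp only [smul_eq_mul]
    module
  have hd := hasDerivAt_comp_line hdiff x (y - x) 0
  have := hc.le_slope_of_hasDerivAt (Set.mem_univ 0) (Set.mem_univ 1) one_pos hd
  simp only [slope_def_field, zero_smul, one_smul, add_zero, add_sub_cancel, sub_zero,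
    div_one] at this
  linarith

/-- The value `f^*(∇f(z)) = ⟨∇f(z), z⟩ - f(z)` of the conjugate at a gradient. -/
noncomputable def conjGrad (f : Vec d → ℝ) (z : Vec d) : ℝ := inner ℝ (gradient f z) z - f z

theorem le_fenchel (f : Vec d → ℝ) (u v : Vec d) : ((inner ℝ u v - f v : ℝ) : EReal) ≤ fenchel f u :=
  le_iSup (fun v : Vec d => ((inner ℝ u v - f v : ℝ) : EReal)) v

theorem fenchel_ne_bot (f : Vec d → ℝ) (u : Vec d) : fenchel f u ≠ ⊥ :=
  ne_bot_of_le_ne_bot (EReal.coe_ne_bot _) (le_fenchel f u 0)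

theorem fenchel_gradient (hconv : ConvexOn ℝ Set.univ f) (hdiff : Differentiable ℝ f) (z : Vec d) :
    fenchel f (gradient f z) = conjGrad f z := by
  refine le_antisymm (iSup_le fun v => ?_) (le_fenchel f _ z)
  have := gradient_inequality hconv hdiff z v
  rw [inner_sub_right] at this
  unfold conjGrad
  exact_mod_cast (by linarith)

/-- The conjugate of an `L`-smooth function lies above its tangents at gradients by a quadratic
`1 / L`: the tangent at `∇f(z)` has the slope `z`. -/
theorem conjGrad_add_le_fenchel (hL : 0 < L) (hdiff : Differentiable ℝ f)
    (hsmooth : ∀ u v, ‖gradient f u - gradient f v‖ ≤ L * ‖u - v‖) (z u : Vec d) :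
    ((conjGrad f z + inner ℝ z (u - gradient f z) + 1 / (2 * L) * ‖u - gradient f z‖ ^ 2 : ℝ) : EReal)
      ≤ fenchel f u := by
  refine le_trans ?_ (le_fenchel f u (z + L⁻¹ • (u - gradient f z)))
  rw [EReal.coe_le_coe_iff]
  have h := apply_add_le_of_smooth hdiff hsmooth z (L⁻¹ • (u - gradient f z))
  have hu : u = (u - gradient f z) + gradient f z := by abel
  set δ := u - gradient f z
  rw [hu]
  rw [norm_smul, Real.norm_eq_abs, abs_of_pos (inv_pos.mpr hL), inner_smul_right] at h
  unfold conjGrad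
  simp only [inner_add_left, inner_add_right, inner_smul_right, real_inner_self_eq_norm_sq]
  rw [real_inner_comm δ z]
  have e1 : L / 2 * (L⁻¹ * ‖δ‖) ^ 2 = 1 / (2 * L) * ‖δ‖ ^ 2 := by field_simp
  have e2 : L⁻¹ * ‖δ‖ ^ 2 = 2 * (1 / (2 * L) * ‖δ‖ ^ 2) := by field_simp
  linarith

/-- The conjugate of an `L`-smooth function is `1 / L`-strongly convex. -/
theorem fenchel_strongly_convex (hL : 0 < L) (hdiff : Differentiable ℝ f)
    (hsmooth : ∀ u v, ‖gradient f u - gradient f v‖ ≤ L * ‖u - v‖) {u v : Vec d} {a b τ : ℝ}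
    (ha : fenchel f u ≤ a) (hb : fenchel f v ≤ b) (h0 : 0 ≤ τ) (h1 : τ ≤ 1) :
    fenchel f ((1 - τ) • u + τ • v) ≤
      (((1 - τ) * a + τ * b - τ * (1 - τ) * (1 / (2 * L) * ‖v - u‖ ^ 2) : ℝ) : EReal) := by
  refine iSup_le fun x => ?_
  rw [EReal.coe_le_coe_iff]
  have hu := (le_fenchel f u (x + -((τ / L) • (v - u)))).trans ha
  have hv := (le_fenchel f v (x + ((1 - τ) / L) • (v - u))).trans hb
  rw [EReal.coe_le_coe_iff] at hu hv
  have h2 := apply_add_le_of_smooth hdiff hsmooth x (-((τ / L) • (v - u)))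
  have h3 := apply_add_le_of_smooth hdiff hsmooth x (((1 - τ) / L) • (v - u))
  have hvu : v = (v - u) + u := by abel
  set δ := v - u
  rw [hvu] at hv ⊢
  simp only [norm_neg, norm_smul, Real.norm_eq_abs, mul_pow, sq_abs, inner_add_right, inner_neg_right,
    inner_smul_right, inner_add_left, inner_smul_left, RCLike.conj_to_real,
    real_inner_self_eq_norm_sq] at hu hv h2 h3 ⊢
  have h4 := mul_le_mul_of_nonneg_left hu (sub_nonneg.mpr h1)
  have h5 := mul_le_mul_of_nonneg_left hv h0
  have h6 := mul_le_mul_of_nonneg_left h2 (sub_nonneg.mpr h1)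
  have h7 := mul_le_mul_of_nonneg_left h3 h0
  have e : τ * (1 - τ) * (1 / (2 * L) * ‖δ‖ ^ 2) = τ * ((1 - τ) / L * ‖δ‖ ^ 2)
     - (1 - τ) * (L / 2 * ((τ / L) ^ 2 * ‖δ‖ ^ 2)) - τ * (L / 2 * (((1 - τ) / L) ^ 2 * ‖δ‖ ^ 2)) := by
    field_simp; ring
  rw [e]
  have e2 : (1 - τ) * (τ / L * inner ℝ u δ) = τ * ((1 - τ) / L * inner ℝ u δ) := by ring
  have e3 : (1 - τ) * (τ / L * inner ℝ (gradient f x) δ)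
    = τ * ((1 - τ) / L * inner ℝ (gradient f x) δ) := by ring
  linarith

theorem gradient_mem_orthogonal_flatSpace (hdiff : Differentiable ℝ f) (x : Vec d) :
    gradient f x ∈ (flatSpace f)ᗮ := by
  rw [Submodule.mem_orthogonal']
  intro v hv
  have h1 := hasDerivAt_comp_line hdiff x v 0
  have h2 : (fun s : ℝ => f (x + s • v)) = fun _ => f x := funext fun s => hv x s
  rw [h2] at h1
  simpa using h1.unique (hasDerivAt_const 0 _)

end Conjugate

end DVR

/-! ### The constants of a decentralized problem -/

namespace DVR

namespace Problem

open scoped Matrix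

variable {n m d : ℕ}

/-- The standing assumptions: at least two nodes and one component per node, positive
regularizations, a connected graph with non-zero weights, convex smooth components. -/
structure Admissible (P : Problem n m d) : Prop where
  two_le : 2 ≤ n
  one_le : 1 ≤ m
  σ_pos : ∀ i, 0 < P.σ i
  connected : P.G.Connected
  w_ne : ∀ e, P.w e ≠ 0
  L_pos : ∀ i j, 0 < P.L i j
  convex : ∀ i j, ConvexOn ℝ Set.univ (P.f i j)
  diff : ∀ i j, Differentiable ℝ (P.f i j)
  smooth : ∀ i j u v, ‖gradient (P.f i j) u - gradient (P.f i j) v‖ ≤ P.L i j * ‖u - v‖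

theorem dotProduct_transpose_mul_diagonal_mul {ι κ : Type*} [Fintype ι] [Fintype κ] [DecidableEq ι]
    (A : Matrix ι κ ℝ) (D : ι → ℝ) (v : κ → ℝ) :
    v ⬝ᵥ ((A.transpose * Matrix.diagonal D * A) *ᵥ v) = ∑ i, D i * (A *ᵥ v) i ^ 2 := by
  rw [← Matrix.mulVec_mulVec, ← Matrix.mulVec_mulVec, Matrix.dotProduct_mulVec,
    Matrix.vecMul_transpose, dotProduct]
  refine Finset.sum_congr rfl fun i _ => ?_
  rw [Matrix.mulVec_diagonal]
  ring

theorem isSymm_transpose_mul_diagonal_mul {ι κ : Type*} [Fintype ι] [DecidableEq ι]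
    (A : Matrix ι κ ℝ) (D : ι → ℝ) : (A.transpose * Matrix.diagonal D * A).IsSymm := by
  rw [Matrix.IsSymm]
  simp [Matrix.transpose_mul, Matrix.mul_assoc]

theorem mulVec_eq_zero_of_transpose_mul_diagonal_mul {ι κ : Type*} [Fintype ι] [Fintype κ]
    [DecidableEq ι] {A : Matrix ι κ ℝ} {D : ι → ℝ} (hD : ∀ i, 0 < D i) {v : κ → ℝ}
    (h : (A.transpose * Matrix.diagonal D * A) *ᵥ v = 0) : A *ᵥ v = 0 := by
  have h1 := dotProduct_transpose_mul_diagonal_mul A D v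
  rw [h, dotProduct_zero, eq_comm, Finset.sum_eq_zero_iff_of_nonneg
    (fun i _ => mul_nonneg (hD i).le (sq_nonneg _))] at h1
  ext i
  have h2 := h1 i (Finset.mem_univ _)
  simpa [(hD i).ne'] using h2

theorem transpose_mul_diagonal_mul_ne_zero {ι κ : Type*} [Fintype ι] [Fintype κ]
    [DecidableEq ι] {A : Matrix ι κ ℝ} {D : ι → ℝ} (hD : ∀ i, 0 < D i) (hA : A ≠ 0) :
    A.transpose * Matrix.diagonal D * A ≠ 0 := by
  intro h
  apply hA
  rw [Matrix.ext_iff_mulVec]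
  intro v
  rw [Matrix.zero_mulVec]
  exact mulVec_eq_zero_of_transpose_mul_diagonal_mul hD (by rw [h, Matrix.zero_mulVec])

/-- `λ_max(∑_j L_{ij} P_{ij})`. -/
noncomputable def nodeSmooth (P : Problem n m d) (i : Fin n) : ℝ := lamMax (∑ j, P.L i j • P.proj i j)

variable {P : Problem n m d}

theorem proj_proj (i : Fin n) (j : Fin m) (v : Vec d) :
    P.proj i j (P.proj i j v) = P.proj i j v :=
  Submodule.starProjection_eq_self_iff.mpr (Submodule.starProjection_apply_mem _ _)

theorem inner_proj_left (i : Fin n) (j : Fin m) (u v : Vec d) :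
    inner ℝ (P.proj i j u) v = inner ℝ u (P.proj i j v) :=
  Submodule.inner_starProjection_left_eq_right _ _ _

theorem sum_proj_isSymmetric (i : Fin n) :
    LinearMap.IsSymmetric (((∑ j, P.L i j • P.proj i j : Vec d →L[ℝ] Vec d)) : Vec d →ₗ[ℝ] Vec d) := by
  intro u v
  simp [sum_inner, inner_sum, inner_smul_left, inner_smul_right, inner_proj_left]

theorem inner_sum_proj (i : Fin n) (v : Vec d) :
    inner ℝ ((∑ j, P.L i j • P.proj i j : Vec d →L[ℝ] Vec d) v) v =
      ∑ j, P.L i j * ‖P.proj i j v‖ ^ 2 := by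
  simp only [FunLike.coe_sum, Finset.sum_apply, FunLike.coe_smul,
    Pi.smul_apply, sum_inner, inner_smul_left, RCLike.conj_to_real]
  refine Finset.sum_congr rfl fun j _ => ?_
  rw [← real_inner_self_eq_norm_sq, inner_proj_left, inner_proj_left, proj_proj]

namespace Admissible

variable (h : P.Admissible)
include h

theorem aComm_ne_zero : P.aComm ≠ 0 := by
  have hn := h.two_le
  obtain ⟨i, hi⟩ : ∃ i, P.G.Adj ⟨0, by omega⟩ i := by
    have : Nontrivial (Fin n) := Fin.nontrivial_iff_two_le.mpr hn
    exact h.connected.preconnected.exists_adj_of_nontrivial _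
  have hlt : (⟨0, by omega⟩ : Fin n) < i := by
    refine lt_of_le_of_ne (Fin.mk_le_of_le_val (Nat.zero_le _)) hi.ne
  intro h0
  have h1 := congrFun (congrFun h0 ⟨0, by omega⟩) ⟨(⟨0, by omega⟩, i), hlt, hi⟩
  simp [aComm, hlt.ne, h.w_ne] at h1

theorem nodeSmooth_nonneg (i : Fin n) : 0 ≤ P.nodeSmooth i := by
  rw [nodeSmooth, lamMax_continuousLinearMap]
  refine Real.sSup_nonneg fun r hr => ?_
  obtain ⟨v, hv⟩ := (Module.End.hasEigenvalue_iff_mem_spectrum.mpr hr).exists_hasEigenvector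
  have h1 := inner_sum_proj (P := P) i v
  have h2 : (∑ j, P.L i j • P.proj i j : Vec d →L[ℝ] Vec d) v = r • v := hv.apply_eq_smul
  rw [h2, real_inner_smul_left, real_inner_self_eq_norm_sq] at h1
  have h4 : 0 < ‖v‖ ^ 2 := by have := norm_pos_iff.mpr hv.2; positivity
  refine nonneg_of_mul_nonneg_left (b := ‖v‖ ^ 2) ?_ h4
  rw [h1]
  exact Finset.sum_nonneg fun j _ => mul_nonneg (h.L_pos i j).le (sq_nonneg _)

/-- A sum of vectors of the ranges of the projectors `P_{ij}`, `j = 1, …, m`, is controlled by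
`λ_max(∑_j L_{ij} P_{ij})` times the sum of their squared norms weighted by `1 / L_{ij}`. -/
theorem norm_sum_sq_le (i : Fin n) {w : Fin m → Vec d} (hw : ∀ j, P.proj i j (w j) = w j) :
    ‖∑ j, w j‖ ^ 2 ≤ P.nodeSmooth i * ∑ j, ‖w j‖ ^ 2 / P.L i j := by
  set s := ∑ j, w j with hs
  have h1 : ‖s‖ ^ 2 = ∑ j, inner ℝ (P.proj i j s) (w j) := by
    simp_rw [inner_proj_left, hw]
    rw [← inner_sum, ← hs, real_inner_self_eq_norm_sq]
  have h2 : ‖s‖ ^ 2 ≤ ∑ j, (√(P.L i j) * ‖P.proj i j s‖) * (‖w j‖ / √(P.L i j)) := by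
    rw [h1]
    refine Finset.sum_le_sum fun j _ => (real_inner_le_norm _ _).trans (le_of_eq ?_)
    have := (Real.sqrt_pos.mpr (h.L_pos i j)).ne'
    field_simp
  have h3 := Finset.sum_mul_sq_le_sq_mul_sq Finset.univ (fun j => √(P.L i j) * ‖P.proj i j s‖)
    (fun j => ‖w j‖ / √(P.L i j))
  simp only [mul_pow, div_pow, Real.sq_sqrt (h.L_pos i _).le] at h3
  have h4 : ∑ j, P.L i j * ‖P.proj i j s‖ ^ 2 ≤ P.nodeSmooth i * ‖s‖ ^ 2 := by
    rw [← inner_sum_proj, nodeSmooth, lamMax_continuousLinearMap]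
    exact inner_map_self_le_lamMax (sum_proj_isSymmetric i) s
  set N := ∑ j, ‖w j‖ ^ 2 / P.L i j
  have hN : 0 ≤ N := Finset.sum_nonneg fun j _ => div_nonneg (sq_nonneg _) (h.L_pos i j).le
  have h5 : (‖s‖ ^ 2) ^ 2 ≤ P.nodeSmooth i * ‖s‖ ^ 2 * N :=
    (pow_le_pow_left₀ (sq_nonneg _) h2 2).trans (h3.trans (mul_le_mul_of_nonneg_right h4 hN))
  rcases (sq_nonneg ‖s‖).eq_or_lt with h0 | h0
  · rw [← h0]
    exact mul_nonneg (h.nodeSmooth_nonneg i) hN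
  · refine le_of_mul_le_mul_right (le_of_eq_of_le (sq (‖s‖ ^ 2)).symm (h5.trans (le_of_eq ?_))) h0
    ring

theorem dM_inv : P.dM⁻¹ = Matrix.diagonal fun i => (P.σ i + P.nodeSmooth i)⁻¹ := by
  refine Matrix.inv_eq_right_inv ?_
  rw [dM, Matrix.diagonal_mul_diagonal, ← Matrix.diagonal_one]
  congr 1
  ext i
  exact mul_inv_cancel₀ (add_pos_of_pos_of_nonneg (h.σ_pos i) (h.nodeSmooth_nonneg i)).ne'

theorem dM_inv_pos (i : Fin n) : 0 < (P.σ i + P.nodeSmooth i)⁻¹ :=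
  inv_pos.mpr (add_pos_of_pos_of_nonneg (h.σ_pos i) (h.nodeSmooth_nonneg i))

omit h in
theorem sum_sq_mulVec_le (v : Edge P.G → ℝ) :
    ∑ i, (P.σ i)⁻¹ * (P.aComm *ᵥ v) i ^ 2 ≤ P.commSmooth * ∑ e, v e ^ 2 := by
  rw [← dotProduct_transpose_mul_diagonal_mul]
  refine (dotProduct_mulVec_le_lamMax (isSymm_transpose_mul_diagonal_mul _ _) v).trans (le_of_eq ?_)
  simp [commSmooth, sigmaComm, dotProduct, sq]

theorem le_sum_sq_mulVec {v : Edge P.G → ℝ} (hv : ∀ u, P.aComm *ᵥ u = 0 → u ⬝ᵥ v = 0) :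
    P.commConvex * ∑ e, v e ^ 2 ≤ ∑ i, (P.σ i + P.nodeSmooth i)⁻¹ * (P.aComm *ᵥ v) i ^ 2 := by
  rw [← dotProduct_transpose_mul_diagonal_mul]
  refine le_of_eq_of_le ?_ (lamMinPos_le_dotProduct_mulVec (isSymm_transpose_mul_diagonal_mul _ _)
    fun u hu => hv u (mulVec_eq_zero_of_transpose_mul_diagonal_mul h.dM_inv_pos hu))
  simp [commConvex, h.dM_inv, dotProduct, sq]

theorem commConvex_pos : 0 < P.commConvex := by
  rw [commConvex, h.dM_inv]
  refine lamMinPos_pos_of_matrix (isSymm_transpose_mul_diagonal_mul _ _) (fun v => ?_)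
    (transpose_mul_diagonal_mul_ne_zero h.dM_inv_pos h.aComm_ne_zero)
  rw [dotProduct_transpose_mul_diagonal_mul]
  exact Finset.sum_nonneg fun i _ => mul_nonneg (h.dM_inv_pos i).le (sq_nonneg _)

theorem commSmooth_pos : 0 < P.commSmooth := by
  have hpos : ∀ i, 0 < (P.σ i)⁻¹ := fun i => inv_pos.mpr (h.σ_pos i)
  refine lamMax_pos_of_matrix (isSymm_transpose_mul_diagonal_mul _ _) (fun v => ?_)
    (transpose_mul_diagonal_mul_ne_zero hpos h.aComm_ne_zero)
  rw [sigmaComm, dotProduct_transpose_mul_diagonal_mul]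
  exact Finset.sum_nonneg fun i _ => mul_nonneg (hpos i).le (sq_nonneg _)

theorem commConvex_le_commSmooth : P.commConvex ≤ P.commSmooth := by
  -- a non-zero vector of the range of `A_commᵀ` is orthogonal to the kernel of `A_comm`
  obtain ⟨u, hu⟩ : ∃ u, P.aComm.transpose *ᵥ u ≠ 0 := by
    by_contra! hall
    apply h.aComm_ne_zero
    rw [← Matrix.transpose_eq_zero, Matrix.ext_iff_mulVec]
    intro v; rw [hall, Matrix.zero_mulVec]
  set v := P.aComm.transpose *ᵥ u
  have hv : 0 < ∑ e, v e ^ 2 := by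
    obtain ⟨e, he⟩ := Function.ne_iff.mp hu
    exact Finset.sum_pos' (fun _ _ => sq_nonneg _) ⟨e, Finset.mem_univ _, by
      have : v e ≠ 0 := he
      positivity⟩
  refine le_of_mul_le_mul_right ?_ hv
  refine (h.le_sum_sq_mulVec fun k hk => ?_).trans (le_trans ?_ (sum_sq_mulVec_le v))
  · rw [Matrix.dotProduct_mulVec, Matrix.vecMul_transpose, hk, zero_dotProduct]
  · refine Finset.sum_le_sum fun i _ => mul_le_mul_of_nonneg_right ?_ (sq_nonneg _)
    exact inv_anti₀ (h.σ_pos i) (by linarith [h.nodeSmooth_nonneg i])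

theorem gap_pos : 0 < P.gap := by
  obtain ⟨B, hB⟩ : ∃ B : Matrix (Edge P.G) (Fin n) ℝ, B = P.aComm.transpose := ⟨_, rfl⟩
  have hW : P.gossip = B.transpose * Matrix.diagonal (fun _ : Edge P.G => (1 : ℝ)) * B := by
    rw [hB, Matrix.diagonal_one, Matrix.mul_one, Matrix.transpose_transpose, gossip]
  have h0 : B.transpose * Matrix.diagonal (fun _ : Edge P.G => (1 : ℝ)) * B ≠ 0 :=
    transpose_mul_diagonal_mul_ne_zero (fun _ => one_pos)
      fun h0 => h.aComm_ne_zero (Matrix.transpose_eq_zero.mp (hB ▸ h0))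
  have hpos : ∀ v : Fin n → ℝ, 0 ≤ v ⬝ᵥ
      ((B.transpose * Matrix.diagonal (fun _ : Edge P.G => (1 : ℝ)) * B) *ᵥ v) := fun v => by
    rw [dotProduct_transpose_mul_diagonal_mul]
    exact Finset.sum_nonneg fun i _ => mul_nonneg zero_le_one (sq_nonneg _)
  rw [gap, hW]
  exact div_pos (lamMinPos_pos_of_matrix (isSymm_transpose_mul_diagonal_mul _ _) hpos h0)
    (lamMax_pos_of_matrix (isSymm_transpose_mul_diagonal_mul _ _) hpos h0)

theorem alpha_pos : 0 < P.alpha := mul_pos two_pos h.commConvex_pos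

theorem mu_pos (i : Fin n) (j : Fin m) : 0 < P.mu i j :=
  Real.sqrt_pos.mpr (mul_pos h.alpha_pos (h.L_pos i j))

theorem L_div_mu_sq (i : Fin n) (j : Fin m) : P.L i j / P.mu i j ^ 2 = P.alpha⁻¹ := by
  rw [mu, Real.sq_sqrt (mul_pos h.alpha_pos (h.L_pos i j)).le]
  have := (h.L_pos i j).ne'
  have := h.alpha_pos.ne'
  field_simp

/-- The relative condition number of the communication block,
`λ_max(A_commᵀ Σ_comm A_comm) / λ_min⁺(A_commᵀ D_M⁻¹ A_comm)`. -/
theorem kappaComm_div_gap : P.kappaComm / P.gap = P.commSmooth / P.commConvex := by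
  have := h.gap_pos.ne'
  have := h.commConvex_pos.ne'
  rw [kappaComm]
  field_simp

end Admissible

/-- The two normalizations of the stochastic condition number `κ_s`. -/
def IsStochasticCondition (P : Problem n m d) (κs : ℝ) : Prop :=
  κs = (⨆ i, (1 + ∑ j, P.L i j) / P.σ i) ∨ κs = ⨆ i, (1 + (∑ j, P.L i j) / P.σ i)

theorem IsStochasticCondition.le {κs : ℝ} (hκ : P.IsStochasticCondition κs) (h : P.Admissible)
    (i : Fin n) : ∑ j, P.L i j / P.σ i ≤ κs := by
  rw [← Finset.sum_div]
  have hb : ∀ g : Fin n → ℝ, BddAbove (Set.range g) := fun g => (Set.finite_range g).bddAbove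
  have hσ := h.σ_pos i
  rcases hκ with rfl | rfl
  · refine le_trans ?_ (le_ciSup (hb _) i)
    gcongr
    linarith
  · refine le_trans ?_ (le_ciSup (hb _) i)
    linarith

theorem IsStochasticCondition.pos {κs : ℝ} (hκ : P.IsStochasticCondition κs) (h : P.Admissible) :
    0 < κs := by
  have hn := h.two_le
  have hm := h.one_le
  refine lt_of_lt_of_le ?_ (hκ.le h ⟨0, by omega⟩)
  have : Nonempty (Fin m) := ⟨⟨0, by omega⟩⟩
  exact Finset.sum_pos (fun j _ => div_pos (h.L_pos _ j) (h.σ_pos _)) Finset.univ_nonempty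

end Problem

end DVR

/-! ### Geometry of the dual problem -/

namespace DVR

namespace Problem

variable {n m d : ℕ} {P : Problem n m d}

theorem augA_inl (lam : P.DualVar) (i : Fin n) : P.augA lam (Sum.inl i) =
    ∑ e, P.aComm i e • lam (Sum.inl e) - ∑ j, P.mu i j • P.proj i j (lam (Sum.inr (i, j))) := rfl

theorem augA_inr (lam : P.DualVar) (i : Fin n) (j : Fin m) : P.augA lam (Sum.inr (i, j)) =
    P.mu i j • P.proj i j (lam (Sum.inr (i, j))) := rfl

theorem augA_inl_add_sum_inr (lam : P.DualVar) (i : Fin n) :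
    P.augA lam (Sum.inl i) + ∑ j, P.augA lam (Sum.inr (i, j)) =
      ∑ e, P.aComm i e • lam (Sum.inl e) := by
  simp only [augA_inl, augA_inr, sub_add_cancel]

theorem commPart_inl (a : P.DualVar) (e : Edge P.G) :
    P.commPart a (Sum.inl e) = a (Sum.inl e) := rfl

theorem commPart_inr (a : P.DualVar) (ij : Fin n × Fin m) : P.commPart a (Sum.inr ij) = 0 := rfl

theorem commPart_sub (a b : P.DualVar) : P.commPart (a - b) = P.commPart a - P.commPart b := by
  ext k : 1
  rcases k with e | ij
  · rfl
  · rw [PiLp.sub_apply, commPart_inr, commPart_inr, commPart_inr, sub_zero]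

theorem inner_dualVar (a b : P.DualVar) : inner ℝ a b =
    ∑ e, inner ℝ (a (Sum.inl e)) (b (Sum.inl e)) +
      ∑ i, ∑ j, inner ℝ (a (Sum.inr (i, j))) (b (Sum.inr (i, j))) := by
  rw [PiLp.inner_apply, Fintype.sum_sum_type, Fintype.sum_prod_type]

theorem inner_gradient_half_sum_norm_sq {ι E F : Type*} [Fintype ι] [NormedAddCommGroup E]
    [InnerProductSpace ℝ E] [FiniteDimensional ℝ E] [NormedAddCommGroup F] [InnerProductSpace ℝ F]
    (T : ι → E →ₗ[ℝ] F) (c : ι → ℝ) (x v : E) :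
    inner ℝ (gradient (fun y => 1 / 2 * ∑ i, c i * ‖T i y‖ ^ 2) x) v =
      ∑ i, c i * inner ℝ (T i x) (T i v) := by
  have h1 := (HasFDerivAt.fun_sum fun i (_ : i ∈ Finset.univ) =>
    ((T i).toContinuousLinearMap.hasFDerivAt (x := x)).norm_sq.const_mul (c i)).const_mul (1 / 2)
  simp only [LinearMap.coe_toContinuousLinearMap'] at h1
  rw [gradient, InnerProductSpace.toDual_symm_apply, h1.fderiv]
  simp only [FunLike.coe_smul, FunLike.coe_sum, Pi.smul_apply, Finset.sum_apply,
    ContinuousLinearMap.coe_comp, Function.comp_apply, innerSL_apply_apply, smul_eq_mul,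
    Pi.mul_apply, nsmul_eq_mul, Finset.mul_sum, Pi.natCast_apply, LinearMap.coe_toContinuousLinearMap']
  refine Finset.sum_congr rfl fun i _ => ?_
  push_cast
  ring

/-- The coordinate `i` of `A λ`, as a linear map of `λ`. -/
noncomputable def augANode (P : Problem n m d) (i : Fin n) : P.DualVar →ₗ[ℝ] Vec d :=
  (PiLp.projₗ 2 (fun _ : Fin n ⊕ (Fin n × Fin m) => Vec d) (Sum.inl i)).comp P.augA

theorem qA_eq : P.qA = fun lam => 1 / 2 * ∑ i, (P.σ i)⁻¹ * ‖P.augANode i lam‖ ^ 2 := rfl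

/-- The gradient of `q_A` in the communication coordinates is `A_commᵀ Σ (A λ)`. -/
theorem gradient_qA_inl (lam : P.DualVar) (e : Edge P.G) :
    gradient P.qA lam (Sum.inl e) =
      ∑ i, P.aComm i e • (P.σ i)⁻¹ • P.augA lam (Sum.inl i) := by
  refine ext_inner_right ℝ fun v => ?_
  let V : P.DualVar := WithLp.toLp 2 (Sum.elim (fun e' => if e' = e then v else 0) fun _ => 0)
  have h4 : inner ℝ (gradient P.qA lam) V =
      ∑ i, (P.σ i)⁻¹ * inner ℝ (P.augA lam (Sum.inl i)) (P.augA V (Sum.inl i)) := by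
    rw [qA_eq]
    exact inner_gradient_half_sum_norm_sq P.augANode (fun i => (P.σ i)⁻¹) lam V
  have h5 : inner ℝ (gradient P.qA lam) V = inner ℝ (gradient P.qA lam (Sum.inl e)) v := by
    rw [inner_dualVar]
    have : ∀ e', inner ℝ (gradient P.qA lam (Sum.inl e')) (V (Sum.inl e')) =
        if e' = e then inner ℝ (gradient P.qA lam (Sum.inl e)) v else 0 := by
      intro e'
      change inner ℝ (gradient P.qA lam (Sum.inl e')) (if e' = e then v else 0) = _
      split_ifs with he
      · rw [he]
      · rw [inner_zero_right]
    simp only [this, Finset.sum_ite_eq', Finset.mem_univ, if_true]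
    simp [V]
  have h6 : ∀ i, P.augA V (Sum.inl i) = P.aComm i e • v := by
    intro i
    rw [augA_inl]
    simp [V]
  rw [← h5, h4]
  simp only [h6, sum_inner, inner_smul_left, inner_smul_right, RCLike.conj_to_real]
  refine Finset.sum_congr rfl fun i _ => ?_
  ring

/-! ### The projector `A† A` -/

theorem inner_pinvA_left (a b : P.DualVar) : inner ℝ (P.pinvA a) b = inner ℝ a (P.pinvA b) :=
  Submodule.inner_starProjection_left_eq_right _ _ _

theorem pinvA_pinvA (a : P.DualVar) : P.pinvA (P.pinvA a) = P.pinvA a :=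
  Submodule.starProjection_eq_self_iff.mpr (Submodule.starProjection_apply_mem _ _)

theorem inner_pinvA_self (a : P.DualVar) : inner ℝ a (P.pinvA a) = ‖P.pinvA a‖ ^ 2 := by
  rw [← real_inner_self_eq_norm_sq, inner_pinvA_left, pinvA_pinvA]

theorem inner_pinvA_of_mem_ker {k : P.DualVar} (hk : P.augA k = 0) (a : P.DualVar) :
    inner ℝ k (P.pinvA a) = 0 :=
  (Submodule.mem_orthogonal _ _).mp (Submodule.starProjection_apply_mem _ _) k hk

theorem pinvA_eq_self {a : P.DualVar} (ha : ∀ k, P.augA k = 0 → inner ℝ k a = 0) :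
    P.pinvA a = a :=
  Submodule.starProjection_eq_self_iff.mpr ((Submodule.mem_orthogonal _ _).mpr fun k hk => ha k hk)

theorem augA_sub_pinvA (a : P.DualVar) : P.augA (a - P.pinvA a) = 0 := by
  have h := Submodule.sub_starProjection_mem_orthogonal (K := (LinearMap.ker P.augA)ᗮ) a
  rw [Submodule.orthogonal_orthogonal] at h
  exact h

/-- `A† A` leaves the communication coordinates and the virtual coordinates separate. -/
theorem pinvA_commPart_inr (hP : P.Admissible) (a : P.DualVar) (i : Fin n) (j : Fin m) :
    P.pinvA (P.commPart a) (Sum.inr (i, j)) = 0 := by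
  set w := P.pinvA (P.commPart a) with hw
  have hk := augA_sub_pinvA (P.commPart a)
  rw [← hw] at hk
  have h1 : ∀ i j, P.proj i j (w (Sum.inr (i, j))) = 0 := by
    intro i j
    have h2 : P.augA (P.commPart a - w) (Sum.inr (i, j)) = 0 := by rw [hk]; rfl
    rw [augA_inr, PiLp.sub_apply, commPart_inr, zero_sub, map_neg, smul_neg, neg_eq_zero,
      smul_eq_zero] at h2
    exact h2.resolve_left (hP.mu_pos i j).ne'
  let y : P.DualVar := WithLp.toLp 2 (Sum.elim (fun _ => 0) fun ij => w (Sum.inr ij))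
  have hy : P.augA y = 0 := by
    ext k : 1
    rcases k with i | ⟨i, j⟩
    · rw [augA_inl]
      simp [y, h1]
    · rw [augA_inr]
      simp [y, h1]
  have h3 := inner_pinvA_of_mem_ker hy (P.commPart a)
  rw [← hw, inner_dualVar] at h3
  simp only [y, Sum.elim_inl, Sum.elim_inr, inner_zero_left, Finset.sum_const_zero, zero_add] at h3
  rw [Finset.sum_eq_zero_iff_of_nonneg fun i _ => Finset.sum_nonneg fun j _ =>
    real_inner_self_nonneg] at h3
  have h4 := h3 i (Finset.mem_univ _)
  rw [Finset.sum_eq_zero_iff_of_nonneg fun j _ => real_inner_self_nonneg] at h4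
  exact inner_self_eq_zero.mp (h4 j (Finset.mem_univ _))

theorem sum_aComm_pinvA (hP : P.Admissible) (a : P.DualVar) (i : Fin n) :
    ∑ e, P.aComm i e • P.pinvA (P.commPart a) (Sum.inl e) = ∑ e, P.aComm i e • a (Sum.inl e) := by
  have hk : P.augA (P.commPart a - P.pinvA (P.commPart a)) (Sum.inl i) = 0 := by
    rw [augA_sub_pinvA]; rfl
  rw [augA_inl] at hk
  simp only [PiLp.sub_apply, commPart_inl, commPart_inr, pinvA_commPart_inr hP, sub_zero, map_zero,
    smul_zero, Finset.sum_const_zero, smul_sub, Finset.sum_sub_distrib] at hk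
  exact (sub_eq_zero.mp hk).symm

theorem inner_pinvA_commPart (hP : P.Admissible) (a b : P.DualVar) :
    inner ℝ (P.pinvA (P.commPart a)) b = inner ℝ (P.pinvA (P.commPart a)) (P.commPart b) := by
  simp only [inner_dualVar, commPart_inl, pinvA_commPart_inr hP, inner_zero_left]

theorem norm_sq_eq_sum_coord {d : ℕ} (v : Vec d) : ‖v‖ ^ 2 = ∑ l, v l ^ 2 := by
  rw [EuclideanSpace.norm_sq_eq]; simp

/-- The lower spectral bound for the communication coordinates: `λ_min⁺(A_commᵀ D_M⁻¹ A_comm)` times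
`‖x‖²_{A† A}` is at most `‖A_comm x‖²_{D_M⁻¹}`. -/
theorem commConvex_mul_norm_pinvA_le (hP : P.Admissible) (a : P.DualVar) :
    P.commConvex * ‖P.pinvA (P.commPart a)‖ ^ 2 ≤
      ∑ i, (P.σ i + P.nodeSmooth i)⁻¹ * ‖∑ e, P.aComm i e • a (Sum.inl e)‖ ^ 2 := by
  simp_rw [← sum_aComm_pinvA hP a]
  set w := P.pinvA (P.commPart a) with hw
  have h1 : ‖w‖ ^ 2 = ∑ l, ∑ e, w (Sum.inl e) l ^ 2 := by
    rw [← real_inner_self_eq_norm_sq, inner_dualVar, hw]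
    simp only [pinvA_commPart_inr hP, inner_zero_left, Finset.sum_const_zero, add_zero,
      real_inner_self_eq_norm_sq, norm_sq_eq_sum_coord]
    exact Finset.sum_comm
  have h2 : ∀ i, ‖∑ e, P.aComm i e • w (Sum.inl e)‖ ^ 2 =
      ∑ l, P.aComm.mulVec (fun e => w (Sum.inl e) l) i ^ 2 := by
    intro i
    rw [norm_sq_eq_sum_coord]
    refine Finset.sum_congr rfl fun l _ => ?_
    simp [Matrix.mulVec, dotProduct]
  simp_rw [h2, Finset.mul_sum]
  rw [Finset.sum_comm, h1, Finset.mul_sum]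
  refine Finset.sum_le_sum fun l _ => hP.le_sum_sq_mulVec fun u hu => ?_
  let k : P.DualVar := WithLp.toLp 2
    (Sum.elim (fun e => u e • EuclideanSpace.single l (1 : ℝ)) fun _ => 0)
  have hk : P.augA k = 0 := by
    ext p : 1
    rcases p with i | ⟨i, j⟩
    · rw [augA_inl]
      have h3 := congrFun hu i
      simp only [Matrix.mulVec, dotProduct, Pi.zero_apply] at h3
      simp [k, smul_smul, ← Finset.sum_smul, h3]
    · rw [augA_inr]
      simp [k]
  have h4 := inner_pinvA_of_mem_ker hk (P.commPart a)
  rw [← hw, inner_dualVar] at h4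
  simp only [k, Sum.elim_inl, Sum.elim_inr, inner_zero_left, Finset.sum_const_zero, add_zero,
    inner_smul_left, EuclideanSpace.inner_single_left, RCLike.conj_to_real, map_one, one_mul] at h4
  exact h4

/-- The vector `A_commᵀ θ` in the communication coordinates. -/
noncomputable def commGrad (P : Problem n m d) (θ : Fin n → Vec d) : P.DualVar :=
  WithLp.toLp 2 (Sum.elim (fun e => ∑ i, P.aComm i e • θ i) fun _ => 0)

theorem commGrad_inl (θ : Fin n → Vec d) (e : Edge P.G) :
    P.commGrad θ (Sum.inl e) = ∑ i, P.aComm i e • θ i := rfl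

theorem inner_commGrad (θ : Fin n → Vec d) (a : P.DualVar) :
    inner ℝ (P.commGrad θ) a = ∑ i, inner ℝ (θ i) (∑ e, P.aComm i e • a (Sum.inl e)) := by
  rw [inner_dualVar]
  simp only [commGrad, Sum.elim_inl, Sum.elim_inr, inner_zero_left, Finset.sum_const_zero, add_zero,
    sum_inner, inner_sum, inner_smul_left, inner_smul_right, RCLike.conj_to_real]
  exact Finset.sum_comm

theorem inner_commGrad_commPart (θ : Fin n → Vec d) (a : P.DualVar) :
    inner ℝ (P.commGrad θ) (P.commPart a) = inner ℝ (P.commGrad θ) a := by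
  simp only [inner_commGrad, commPart_inl]

theorem pinvA_commGrad (θ : Fin n → Vec d) :
    P.pinvA (P.commGrad θ) = P.commGrad θ := by
  refine pinvA_eq_self fun k hk => ?_
  rw [real_inner_comm, inner_commGrad]
  refine Finset.sum_eq_zero fun i _ => ?_
  rw [← augA_inl_add_sum_inr, hk]
  simp

/-- The upper spectral bound for the communication coordinates. -/
theorem sum_norm_sq_aComm_le (a : P.DualVar) :
    ∑ i, (P.σ i)⁻¹ * ‖∑ e, P.aComm i e • a (Sum.inl e)‖ ^ 2 ≤
      P.commSmooth * ∑ e, ‖a (Sum.inl e)‖ ^ 2 := by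
  have h2 : ∀ i, ‖∑ e, P.aComm i e • a (Sum.inl e)‖ ^ 2 =
      ∑ l, P.aComm.mulVec (fun e => a (Sum.inl e) l) i ^ 2 := by
    intro i
    rw [norm_sq_eq_sum_coord]
    refine Finset.sum_congr rfl fun l _ => ?_
    simp [Matrix.mulVec, dotProduct]
  simp_rw [h2, norm_sq_eq_sum_coord, Finset.mul_sum]
  rw [Finset.sum_comm]
  conv_rhs => rw [Finset.sum_comm]
  refine Finset.sum_le_sum fun l _ => ?_
  rw [← Finset.mul_sum]
  exact Admissible.sum_sq_mulVec_le _

theorem norm_commGrad_sq (θ : Fin n → Vec d) :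
    ‖P.commGrad θ‖ ^ 2 = ∑ e, ‖P.commGrad θ (Sum.inl e)‖ ^ 2 := by
  rw [← real_inner_self_eq_norm_sq, inner_dualVar]
  simp [commGrad]

end Problem

end DVR

/-! ### Finiteness of the dual values and the Lyapunov quantity -/

namespace DVR

theorem _root_.EReal.coe_sum_real {ι : Type*} (s : Finset ι) (g : ι → ℝ) :
    ((∑ i ∈ s, g i : ℝ) : EReal) = ∑ i ∈ s, (g i : EReal) := by
  classical
  induction s using Finset.induction_on with
  | empty => simp
  | insert a s ha ih => rw [Finset.sum_insert ha, Finset.sum_insert ha, EReal.coe_add, ih]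

namespace Problem

variable {n m d : ℕ} {P : Problem n m d}

/-- The dual iterate and the virtual parameters are linked by `(A λ)^{(ij)} = ∇f_{ij}(z^{(ij)})`. -/
theorem augA_lam_inr (hP : P.Admissible) (s : P.State) (i : Fin n) (j : Fin m) :
    P.augA s.lam (Sum.inr (i, j)) = gradient (P.f i j) (s.z i j) := by
  rw [augA_inr]
  change P.mu i j • P.proj i j ((P.mu i j)⁻¹ • gradient (P.f i j) (s.z i j)) = _
  rw [map_smul, smul_inv_smul₀ (hP.mu_pos i j).ne']
  exact Submodule.starProjection_eq_self_iff.mpr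
    (gradient_mem_orthogonal_flatSpace (hP.diff i j) _)

theorem proj_augA_inr (lam : P.DualVar) (i : Fin n) (j : Fin m) :
    P.proj i j (P.augA lam (Sum.inr (i, j))) = P.augA lam (Sum.inr (i, j)) := by
  rw [augA_inr, map_smul, proj_proj]

theorem dualObj_eq_coe {lam : P.DualVar} {c : Fin n → Fin m → ℝ}
    (hc : ∀ i j, fenchel (P.f i j) (P.augA lam (Sum.inr (i, j))) = c i j) :
    P.dualObj lam = ((-(P.qA lam + ∑ i, ∑ j, c i j) : ℝ) : EReal) := by
  simp only [dualObj, fSumConj, hc, EReal.coe_neg, EReal.coe_add, EReal.coe_sum_real]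

theorem phi_eq_coe {lam : P.DualVar} {c : Fin n → Fin m → ℝ} (hP : P.Admissible)
    (hc : ∀ i j, fenchel (P.f i j) (P.augA lam (Sum.inr (i, j))) = c i j) :
    P.phi lam = ((1 / 2 * ‖P.pinvA (P.commPart lam)‖ ^ 2 + ∑ i, ∑ j, P.alpha⁻¹ * c i j : ℝ)
      : EReal) := by
  simp only [phi, hc, hP.L_div_mu_sq, inner_pinvA_self, EReal.coe_add, EReal.coe_sum_real,
    EReal.coe_mul]

theorem fenchel_lam (hP : P.Admissible) (s : P.State) (i : Fin n) (j : Fin m) :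
    fenchel (P.f i j) (P.augA s.lam (Sum.inr (i, j))) = conjGrad (P.f i j) (s.z i j) := by
  rw [augA_lam_inr hP, fenchel_gradient (hP.convex i j) (hP.diff i j)]

/-- The conjugates are finite at a maximizer of the dual. -/
theorem exists_fenchel_eq_coe (hP : P.Admissible) {lamStar : P.DualVar}
    (hstar : ∀ lam, P.dualObj lam ≤ P.dualObj lamStar) :
    ∃ c : Fin n → Fin m → ℝ,
      ∀ i j, fenchel (P.f i j) (P.augA lamStar (Sum.inr (i, j))) = c i j := by
  classical
  refine ⟨fun i j => (fenchel (P.f i j) (P.augA lamStar (Sum.inr (i, j)))).toReal, fun i j =>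
    (EReal.coe_toReal ?_ (fenchel_ne_bot _ _)).symm⟩
  intro htop
  have h1 := hstar (P.init (fun _ => 0) fun _ _ => 0).lam
  rw [dualObj_eq_coe (fenchel_lam hP _)] at h1
  have h2 : P.fSumConj lamStar = ⊤ := by
    have hbot : ∀ (s : Finset (Fin n × Fin m)), ∑ ij ∈ s,
        fenchel (P.f ij.1 ij.2) (P.augA lamStar (Sum.inr ij)) ≠ ⊥ := by
      intro s
      induction s using Finset.induction_on with
      | empty => simp
      | insert a s ha ih =>
        rw [Finset.sum_insert ha, Ne, EReal.add_eq_bot_iff]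
        exact fun h => h.elim (fenchel_ne_bot _ _) ih
    rw [fSumConj, ← Fintype.sum_prod_type', ← Finset.add_sum_erase _ _ (Finset.mem_univ (i, j)),
      htop]
    exact EReal.top_add_of_ne_bot (hbot _)
  rw [dualObj, h2, EReal.coe_add_top, EReal.neg_top] at h1
  exact absurd h1 (not_le.mpr (EReal.bot_lt_coe _))

/-- The divergence `f^*(u) - f^*(∇f(z)) - ⟨z, u - ∇f(z)⟩` of the conjugate, where `c = f^*(u)`. -/
noncomputable def conjDiv (f : Vec d → ℝ) (c : ℝ) (u z : Vec d) : ℝ :=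
  c - conjGrad f z - inner ℝ z (u - gradient f z)

theorem le_conjDiv (hP : P.Admissible) {i : Fin n} {j : Fin m} {u : Vec d} {c : ℝ}
    (hc : fenchel (P.f i j) u = c) (z : Vec d) :
    1 / (2 * P.L i j) * ‖u - gradient (P.f i j) z‖ ^ 2 ≤ conjDiv (P.f i j) c u z := by
  have h := conjGrad_add_le_fenchel (hP.L_pos i j) (hP.diff i j) (hP.smooth i j) z u
  rw [hc, EReal.coe_le_coe_iff] at h
  unfold conjDiv
  linarith

theorem inner_gradPhi (hP : P.Admissible) (s : P.State) (a : P.DualVar) :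
    inner ℝ s.gradPhi a = inner ℝ (P.pinvA (P.commPart s.lam)) (P.pinvA (P.commPart a)) +
      ∑ i, ∑ j, P.alpha⁻¹ * inner ℝ (s.z i j) (P.augA a (Sum.inr (i, j))) := by
  rw [State.gradPhi, inner_add_left, inner_pinvA_commPart hP, ← inner_pinvA_left, pinvA_pinvA]
  congr 1
  rw [inner_dualVar]
  simp only [Sum.elim_inl, Sum.elim_inr, inner_zero_left, Finset.sum_const_zero, zero_add,
    hP.L_div_mu_sq, inner_smul_left, RCLike.conj_to_real, inner_proj_left, augA_inr, inner_smul_right]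

/-- The divergence of `φ` splits into a squared seminorm of the communication coordinates and the
divergences of the conjugates. -/
theorem bregman_eq (hP : P.Admissible) {lamStar : P.DualVar} {c : Fin n → Fin m → ℝ}
    (hc : ∀ i j, fenchel (P.f i j) (P.augA lamStar (Sum.inr (i, j))) = c i j) (s : P.State) :
    P.bregman s.gradPhi lamStar s.lam = 1 / 2 * ‖P.pinvA (P.commPart (lamStar - s.lam))‖ ^ 2 +
      P.alpha⁻¹ * ∑ i, ∑ j,
        conjDiv (P.f i j) (c i j) (P.augA lamStar (Sum.inr (i, j))) (s.z i j) := by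
  rw [bregman, phi_eq_coe hP hc, phi_eq_coe hP (fenchel_lam hP s), EReal.toReal_coe,
    EReal.toReal_coe, inner_gradPhi hP, commPart_sub, map_sub, norm_sub_sq_real, inner_sub_right,
    real_inner_self_eq_norm_sq, real_inner_comm (P.pinvA (P.commPart s.lam))]
  simp only [conjDiv, map_sub, PiLp.sub_apply, augA_lam_inr hP, Finset.sum_sub_distrib,
    ← Finset.mul_sum]
  ring

/-- The opposite of the dual objective at the iterate of a state. -/
noncomputable def State.dualCost (s : P.State) : ℝ :=
  P.qA s.lam + ∑ i, ∑ j, conjGrad (P.f i j) (s.z i j)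

theorem lyapunov_eq (hP : P.Admissible) {lamStar : P.DualVar} {c : Fin n → Fin m → ℝ}
    (hc : ∀ i j, fenchel (P.f i j) (P.augA lamStar (Sum.inr (i, j))) = c i j) (κs η : ℝ)
    (s : P.State) : P.lyapunov κs η lamStar s =
      P.pMin κs / η * (1 / 2 * ‖P.pinvA (P.commPart (lamStar - s.lam))‖ ^ 2 +
      P.alpha⁻¹ * ∑ i, ∑ j,
        conjDiv (P.f i j) (c i j) (P.augA lamStar (Sum.inr (i, j))) (s.z i j)) +
      (s.dualCost - (P.qA lamStar + ∑ i, ∑ j, c i j)) := by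
  rw [lyapunov, bregman_eq hP hc, dualObj_eq_coe hc, dualObj_eq_coe (fenchel_lam hP s),
    EReal.toReal_coe, EReal.toReal_coe, State.dualCost]
  ring

theorem phi_add_inner_le (hP : P.Admissible) (s : P.State) (lam : P.DualVar) :
    P.phi s.lam + ((inner ℝ s.gradPhi (lam - s.lam) : ℝ) : EReal) ≤ P.phi lam := by
  have h1 : ∀ i j, ((P.alpha⁻¹ * (conjGrad (P.f i j) (s.z i j) + inner ℝ (s.z i j)
      (P.augA (lam - s.lam) (Sum.inr (i, j)))) : ℝ) : EReal) ≤
      ((P.L i j / P.mu i j ^ 2 : ℝ) : EReal) * fenchel (P.f i j) (P.augA lam (Sum.inr (i, j))) := by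
    intro i j
    rw [hP.L_div_mu_sq, EReal.coe_mul]
    refine mul_le_mul_of_nonneg_left (le_trans (EReal.coe_le_coe_iff.mpr ?_)
      (conjGrad_add_le_fenchel (hP.L_pos i j) (hP.diff i j) (hP.smooth i j) (s.z i j) _))
      (EReal.coe_nonneg.mpr (inv_nonneg.mpr hP.alpha_pos.le))
    rw [map_sub, PiLp.sub_apply, augA_lam_inr hP]
    have := hP.L_pos i j
    have : 0 ≤ 1 / (2 * P.L i j) * ‖P.augA lam (Sum.inr (i, j)) -
      gradient (P.f i j) (s.z i j)‖ ^ 2 := by positivity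
    linarith
  have h2 : 1 / 2 * ‖P.pinvA (P.commPart s.lam)‖ ^ 2 + inner ℝ (P.pinvA (P.commPart s.lam))
      (P.pinvA (P.commPart (lam - s.lam))) ≤ 1 / 2 * ‖P.pinvA (P.commPart lam)‖ ^ 2 := by
    rw [commPart_sub, map_sub, inner_sub_right, real_inner_self_eq_norm_sq]
    have := norm_sub_sq_real (P.pinvA (P.commPart s.lam)) (P.pinvA (P.commPart lam))
    nlinarith [sq_nonneg ‖P.pinvA (P.commPart s.lam) - P.pinvA (P.commPart lam)‖]
  calc P.phi s.lam + ((inner ℝ s.gradPhi (lam - s.lam) : ℝ) : EReal)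
      = ((1 / 2 * ‖P.pinvA (P.commPart s.lam)‖ ^ 2 + inner ℝ (P.pinvA (P.commPart s.lam))
          (P.pinvA (P.commPart (lam - s.lam))) : ℝ) : EReal) +
        ∑ i, ∑ j, ((P.alpha⁻¹ * (conjGrad (P.f i j) (s.z i j) + inner ℝ (s.z i j)
          (P.augA (lam - s.lam) (Sum.inr (i, j)))) : ℝ) : EReal) := by
        rw [phi_eq_coe hP (fenchel_lam hP s), inner_gradPhi hP]
        simp only [← EReal.coe_sum_real, ← EReal.coe_add]
        congr 1
        simp only [mul_add, Finset.sum_add_distrib]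
        ring
    _ ≤ P.phi lam := by
        rw [phi, inner_pinvA_self]
        exact add_le_add (EReal.coe_le_coe_iff.mpr h2)
          (Finset.sum_le_sum fun i _ => Finset.sum_le_sum fun j _ => h1 i j)

/-! ### Growth of the dual cost around an optimum -/

theorem qA_convex_combination (a b : P.DualVar) (τ : ℝ) :
    P.qA ((1 - τ) • a + τ • b) =
      (1 - τ) * P.qA a + τ * P.qA b - τ * (1 - τ) * P.qA (b - a) := by
  simp only [qA, map_add, map_smul, map_sub, PiLp.add_apply, PiLp.smul_apply, PiLp.sub_apply,
    Finset.mul_sum, ← Finset.sum_add_distrib, ← Finset.sum_sub_distrib]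
  refine Finset.sum_congr rfl fun i _ => ?_
  rw [norm_add_sq_real, norm_sub_sq_real, norm_smul, norm_smul, inner_smul_left, inner_smul_right,
    mul_pow, mul_pow, Real.norm_eq_abs, Real.norm_eq_abs, sq_abs, sq_abs,
    real_inner_comm (P.augA a (Sum.inl i))]
  simp only [RCLike.conj_to_real]
  ring

/-- The weighted squared distance of the gradients `∇f_{ij}(z^{(ij)})` to `(A λ⋆)^{(ij)}`. -/
noncomputable def gradDist (lamStar : P.DualVar) (s : P.State) : ℝ :=
  ∑ i, ∑ j, 1 / (2 * P.L i j) *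
    ‖gradient (P.f i j) (s.z i j) - P.augA lamStar (Sum.inr (i, j))‖ ^ 2

theorem gradDist_nonneg (hP : P.Admissible) (lamStar : P.DualVar) (s : P.State) :
    0 ≤ P.gradDist lamStar s :=
  Finset.sum_nonneg fun i _ => Finset.sum_nonneg fun j _ => by
    have := hP.L_pos i j
    positivity

theorem qA_nonneg (hP : P.Admissible) (a : P.DualVar) : 0 ≤ P.qA a := by
  have := fun i => inv_pos.mpr (hP.σ_pos i)
  unfold qA
  exact mul_nonneg (by norm_num) (Finset.sum_nonneg fun i _ => mul_nonneg (this i).le (sq_nonneg _))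

/-- The dual cost grows at least as its strong convexity demands around a minimizer: this is
obtained by comparing the optimum with points of the segment to `λ`. -/
theorem qA_add_gradDist_le (hP : P.Admissible) {lamStar : P.DualVar} {c : Fin n → Fin m → ℝ}
    (hc : ∀ i j, fenchel (P.f i j) (P.augA lamStar (Sum.inr (i, j))) = c i j)
    (hstar : ∀ lam, P.dualObj lam ≤ P.dualObj lamStar) (s : P.State) :
    P.qA (s.lam - lamStar) + P.gradDist lamStar s ≤
      s.dualCost - (P.qA lamStar + ∑ i, ∑ j, c i j) := by
  set X := P.qA (s.lam - lamStar) + P.gradDist lamStar s with hX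
  set Y := s.dualCost - (P.qA lamStar + ∑ i, ∑ j, c i j) with hY
  have key : ∀ τ : ℝ, 0 < τ → τ ≤ 1 → (1 - τ) * X ≤ Y := by
    intro τ h0 h1
    let b : Fin n → Fin m → ℝ := fun i j => (1 - τ) * c i j + τ * conjGrad (P.f i j) (s.z i j) -
      τ * (1 - τ) * (1 / (2 * P.L i j) *
        ‖gradient (P.f i j) (s.z i j) - P.augA lamStar (Sum.inr (i, j))‖ ^ 2)
    have h2 : P.fSumConj ((1 - τ) • lamStar + τ • s.lam) ≤ ((∑ i, ∑ j, b i j : ℝ) : EReal) := by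
      simp only [EReal.coe_sum_real, fSumConj]
      refine Finset.sum_le_sum fun i _ => Finset.sum_le_sum fun j _ => ?_
      have h3 := fenchel_strongly_convex (hP.L_pos i j) (hP.diff i j) (hP.smooth i j)
        (hc i j).le (fenchel_lam hP s i j).le h0.le h1
      rw [augA_lam_inr hP] at h3
      simpa only [map_add, map_smul, PiLp.add_apply, PiLp.smul_apply, augA_lam_inr hP] using h3
    have h4 := hstar ((1 - τ) • lamStar + τ • s.lam)
    rw [dualObj_eq_coe hc, dualObj, EReal.coe_neg, EReal.neg_le_neg_iff] at h4
    have h5 := h4.trans (add_le_add le_rfl h2)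
    rw [← EReal.coe_add, EReal.coe_le_coe_iff, qA_convex_combination] at h5
    have h6 : ∑ i, ∑ j, b i j = (1 - τ) * ∑ i, ∑ j, c i j +
        τ * ∑ i, ∑ j, conjGrad (P.f i j) (s.z i j) - τ * (1 - τ) * P.gradDist lamStar s := by
      simp only [b, gradDist, Finset.sum_sub_distrib, Finset.sum_add_distrib, ← Finset.mul_sum]
    rw [h6] at h5
    have h7 : τ * ((1 - τ) * X) ≤ τ * Y := by
      rw [hX, hY, State.dualCost]
      linarith
    exact le_of_mul_le_mul_left h7 h0
  by_contra! hlt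
  have hY0 : 0 ≤ Y := by simpa using key 1 one_pos le_rfl
  have hX0 : 0 < X := hY0.trans_lt hlt
  have h1 := key ((X - Y) / (2 * X)) (div_pos (sub_pos.mpr hlt) (by positivity))
    ((div_le_one (by positivity)).mpr (by linarith))
  have h2 : (1 - (X - Y) / (2 * X)) * X = (X + Y) / 2 := by
    field_simp
    ring
  linarith

end Problem

end DVR

/-! ### Probabilities and step size -/

namespace DVR

namespace Problem

variable {n m d : ℕ} {P : Problem n m d} {κs : ℝ}

theorem Admissible.nonempty_fin_n (hP : P.Admissible) : Nonempty (Fin n) :=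
  ⟨⟨0, by have := hP.two_le; omega⟩⟩

theorem Admissible.nonempty_fin_m (hP : P.Admissible) : Nonempty (Fin m) :=
  ⟨⟨0, by have := hP.one_le; omega⟩⟩

section

variable (hP : P.Admissible) (hκ : P.IsStochasticCondition κs)
include hP hκ

theorem add_kappa_pos : 0 < (m : ℝ) + κs := add_pos_of_nonneg_of_pos (Nat.cast_nonneg m) (hκ.pos hP)

omit hκ in
theorem pComm_eq : P.pComm κs = (1 + (m + κs) * P.commConvex / P.commSmooth)⁻¹ := by
  have := hP.gap_pos.ne'
  have := hP.commConvex_pos.ne'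
  have := hP.commSmooth_pos.ne'
  rw [pComm, kappaComm]
  congr 2
  field_simp

theorem pComm_pos : 0 < P.pComm κs := by
  have := hP.commConvex_pos
  have := hP.commSmooth_pos
  have := add_kappa_pos hP hκ
  rw [pComm_eq hP]
  positivity

theorem pComm_lt_one : P.pComm κs < 1 := by
  have := hP.commConvex_pos
  have := hP.commSmooth_pos
  have := add_kappa_pos hP hκ
  rw [pComm_eq hP]
  refine inv_lt_one_of_one_lt₀ ?_
  have : 0 < (m + κs) * P.commConvex / P.commSmooth := by positivity
  linarith

omit hκ in
theorem one_add_div_pos (i : Fin n) (j : Fin m) : 0 < 1 + P.L i j / P.σ i := by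
  have := hP.L_pos i j
  have := hP.σ_pos i
  positivity

omit hκ in
theorem sum_one_add_div_pos (i : Fin n) : 0 < ∑ j, (1 + P.L i j / P.σ i) := by
  have := hP.nonempty_fin_m
  exact Finset.sum_pos (fun j _ => one_add_div_pos hP i j) Finset.univ_nonempty

theorem pComp_pos (i : Fin n) (j : Fin m) : 0 < P.pComp κs i j :=
  div_pos (mul_pos (sub_pos.mpr (pComm_lt_one hP hκ)) (one_add_div_pos hP i j))
    (sum_one_add_div_pos hP i)

omit hκ in
theorem sum_pComp (i : Fin n) : ∑ j, P.pComp κs i j = 1 - P.pComm κs := by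
  simp only [pComp]
  rw [← Finset.sum_div, ← Finset.mul_sum, mul_div_assoc, div_self (sum_one_add_div_pos hP i).ne',
    mul_one]

omit hP hκ in
theorem pMin_le_pComm : P.pMin κs ≤ P.pComm κs := min_le_left _ _

omit hP hκ in
theorem pMin_le_pComp (i : Fin n) (j : Fin m) : P.pMin κs ≤ P.pComp κs i j :=
  (min_le_right _ _).trans (ciInf_le (Set.finite_range
    fun ij : Fin n × Fin m => P.pComp κs ij.1 ij.2).bddBelow (i, j))

omit hκ in
theorem pMin_eq : P.pMin κs = P.pComm κs ∨ ∃ i j, P.pMin κs = P.pComp κs i j := by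
  have := hP.nonempty_fin_n
  have := hP.nonempty_fin_m
  obtain ⟨ij, hij⟩ := exists_eq_ciInf_of_finite (f := fun ij : Fin n × Fin m => P.pComp κs ij.1 ij.2)
  rcases min_choice (P.pComm κs) (⨅ ij : Fin n × Fin m, P.pComp κs ij.1 ij.2) with h | h
  · exact Or.inl h
  · exact Or.inr ⟨ij.1, ij.2, h.trans hij.symm⟩

theorem pMin_pos : 0 < P.pMin κs := by
  rcases pMin_eq (κs := κs) hP with h | ⟨i, j, h⟩ <;> rw [h]
  · exact pComm_pos hP hκ
  · exact pComp_pos hP hκ i j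

omit hκ in
theorem stepSize_eq : P.stepSize κs = P.pComm κs / P.commSmooth ∨ ∃ i j, P.stepSize κs =
    P.pComp κs i j / (P.alpha * (1 + P.L i j / P.σ i)) := by
  have := hP.nonempty_fin_n
  have := hP.nonempty_fin_m
  obtain ⟨ij, hij⟩ := exists_eq_ciInf_of_finite (f := fun ij : Fin n × Fin m =>
    P.pComp κs ij.1 ij.2 / (P.alpha * (1 + P.L ij.1 ij.2 / P.σ ij.1)))
  rcases min_choice (P.pComm κs / P.commSmooth) (⨅ ij : Fin n × Fin m,
    P.pComp κs ij.1 ij.2 / (P.alpha * (1 + P.L ij.1 ij.2 / P.σ ij.1))) with h | h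
  · exact Or.inl h
  · exact Or.inr ⟨ij.1, ij.2, h.trans hij.symm⟩

theorem stepSize_pos : 0 < P.stepSize κs := by
  rcases stepSize_eq (κs := κs) hP with h | ⟨i, j, h⟩ <;> rw [h]
  · exact div_pos (pComm_pos hP hκ) hP.commSmooth_pos
  · exact div_pos (pComp_pos hP hκ i j) (mul_pos hP.alpha_pos (one_add_div_pos hP i j))

end

section StepSize

variable (hP : P.Admissible) {η : ℝ} (hη : η ≤ P.stepSize κs)
include hP hη

theorem mul_commSmooth_le : η * P.commSmooth ≤ P.pComm κs :=
  (le_div_iff₀ hP.commSmooth_pos).mp (hη.trans (min_le_left _ _))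

theorem alpha_mul_le (i : Fin n) (j : Fin m) :
    P.alpha * η * (1 + P.L i j / P.σ i) ≤ P.pComp κs i j := by
  have h1 := hη.trans ((min_le_right _ _).trans (ciInf_le (Set.finite_range fun ij : Fin n × Fin m =>
    P.pComp κs ij.1 ij.2 / (P.alpha * (1 + P.L ij.1 ij.2 / P.σ ij.1))).bddBelow (i, j)))
  have h2 := (le_div_iff₀ (mul_pos hP.alpha_pos (one_add_div_pos hP i j))).mp h1
  calc _ = η * (P.alpha * (1 + P.L i j / P.σ i)) := by ring
    _ ≤ _ := h2

theorem commConvex_mul_le (hη0 : 0 < η) : P.commConvex * η ≤ P.pComm κs := by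
  have := mul_le_mul_of_nonneg_left hP.commConvex_le_commSmooth hη0.le
  linarith [mul_commSmooth_le hP hη]

/-- Either a computation has the smallest probability and the ratio `α η / (2 p_min)` is at most
`1 / 2`, or the communication has it and the ratio is at most the inverse of the relative condition
number of the communication block. -/
theorem ratio_dichotomy (hκ : P.IsStochasticCondition κs) (hη0 : 0 < η) :
    P.alpha * η / (2 * P.pMin κs) ≤ 1 / 2 ∨
      P.alpha * η / (2 * P.pMin κs) * P.commSmooth ≤ P.commConvex := by
  have hp := pMin_pos hP hκ
  rcases pMin_eq (κs := κs) hP with h | ⟨i, j, h⟩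
  · right
    rw [div_mul_eq_mul_div, div_le_iff₀ (by positivity), h, alpha]
    have h1 := mul_le_mul_of_nonneg_left (mul_commSmooth_le hP hη) hP.commConvex_pos.le
    linarith
  · left
    have h1 := alpha_mul_le hP hη i j
    have h2 : 0 ≤ P.L i j / P.σ i := div_nonneg (hP.L_pos i j).le (hP.σ_pos i).le
    have h3 := mul_pos hP.alpha_pos hη0
    rw [div_le_iff₀ (by positivity), h]
    nlinarith

end StepSize

/-! ### One iteration -/

/-- A state is consistent when `θ = Σ A λ`. -/
def State.Consistent (s : P.State) : Prop :=
  ∀ i, s.θ i = (P.σ i)⁻¹ • P.augA s.lam (Sum.inl i)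

theorem augA_lam_inl (hP : P.Admissible) (s : P.State) (i : Fin n) : P.augA s.lam (Sum.inl i) =
    ∑ e, P.aComm i e • s.x e - ∑ j, gradient (P.f i j) (s.z i j) := by
  have h := augA_inl_add_sum_inr s.lam i
  simp only [augA_lam_inr hP] at h
  exact eq_sub_of_add_eq h

theorem State.Consistent.smul_θ (hP : P.Admissible) {s : P.State} (hs : s.Consistent) (i : Fin n) :
    P.augA s.lam (Sum.inl i) = P.σ i • s.θ i := by
  rw [hs i, smul_inv_smul₀ (hP.σ_pos i).ne']

theorem State.Consistent.qA_lam (hP : P.Admissible) {s : P.State} (hs : s.Consistent) :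
    P.qA s.lam = 1 / 2 * ∑ i, P.σ i * ‖s.θ i‖ ^ 2 := by
  rw [qA]
  congr 1
  refine Finset.sum_congr rfl fun i _ => ?_
  have := hP.σ_pos i
  rw [hs.smul_θ hP, norm_smul, Real.norm_eq_abs, mul_pow, sq_abs]
  field_simp

theorem step_comm_lam {η : ℝ} {s : P.State} (hs : s.Consistent) :
    (P.step κs η s Draw.comm).lam = s.lam - (η / P.pComm κs) • P.commGrad s.θ := by
  ext k : 1
  rcases k with e | ij
  · change s.x e - (η / P.pComm κs) • gradient P.qA s.lam (Sum.inl e) =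
      s.x e - (η / P.pComm κs) • ∑ i, P.aComm i e • s.θ i
    rw [gradient_qA_inl]
    simp only [hs _]
  · change s.lam (Sum.inr ij) = s.lam (Sum.inr ij) - (η / P.pComm κs) • (0 : Vec d)
    rw [smul_zero, sub_zero]

theorem augA_commGrad_inl (θ : Fin n → Vec d) (i : Fin n) :
    P.augA (P.commGrad θ) (Sum.inl i) = ∑ e, P.aComm i e • P.commGrad θ (Sum.inl e) := by
  rw [augA_inl]
  simp [commGrad]

theorem sum_gossip_smul (θ : Fin n → Vec d) (i : Fin n) :
    ∑ k, P.gossip i k • θ k = P.augA (P.commGrad θ) (Sum.inl i) := by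
  rw [augA_commGrad_inl]
  simp only [commGrad_inl, gossip, Matrix.mul_apply, Matrix.transpose_apply, Finset.sum_smul,
    Finset.smul_sum, smul_smul]
  exact Finset.sum_comm

theorem State.Consistent.step (hP : P.Admissible) {η : ℝ} {s : P.State} (hs : s.Consistent)
    (e : Draw n m) : (P.step κs η s e).Consistent := by
  intro i
  cases e with
  | comm =>
    rw [step_comm_lam hs, map_sub, map_smul, PiLp.sub_apply, PiLp.smul_apply, smul_sub, ← hs i,
      ← sum_gossip_smul, smul_comm (P.σ i)⁻¹]
    rfl
  | comp J =>
    have h1 := augA_lam_inl hP s i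
    rw [augA_lam_inl hP]
    have h2 : ∑ j, gradient (P.f i j) ((P.step κs η s (Draw.comp J)).z i j) =
        ∑ j, gradient (P.f i j) (s.z i j) +
          (gradient (P.f i (J i)) ((P.step κs η s (Draw.comp J)).z i (J i)) -
            gradient (P.f i (J i)) (s.z i (J i))) := by
      rw [← sub_eq_iff_eq_add', ← Finset.sum_sub_distrib]
      refine Finset.sum_eq_single (J i) (fun j _ hj => ?_) (fun hj => absurd (Finset.mem_univ _) hj)
      simp [Problem.step, hj]
    have h3 : (P.step κs η s (Draw.comp J)).θ i = s.θ i - (P.σ i)⁻¹ •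
        (gradient (P.f i (J i)) ((P.step κs η s (Draw.comp J)).z i (J i)) -
          gradient (P.f i (J i)) (s.z i (J i))) := by
      simp [Problem.step]
    rw [h3, h2, hs i, ← smul_sub, h1, sub_sub]
    rfl

/-- The linear term of the communication block at a consistent state: `⟨∇_x q_A(λ), x⋆ - x⟩`. -/
noncomputable def commLin (lamStar : P.DualVar) (s : P.State) : ℝ :=
  inner ℝ (P.commGrad s.θ) (lamStar - s.lam)

/-- The linear term of the block `(i, j)`, `⟨∇_{ij}(q_A + f_sum^*)(λ), y⋆ - y⟩`. -/
noncomputable def compLin (lamStar : P.DualVar) (s : P.State) (i : Fin n) (j : Fin m) : ℝ :=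
  inner ℝ (s.z i j - s.θ i) (P.augA lamStar (Sum.inr (i, j)) - gradient (P.f i j) (s.z i j))

variable {lamStar : P.DualVar} {c : Fin n → Fin m → ℝ} {η : ℝ}

theorem dualCost_step_comm {s : P.State} (hs : s.Consistent) :
    (P.step κs η s Draw.comm).dualCost = s.dualCost -
      η / P.pComm κs * ‖P.commGrad s.θ‖ ^ 2 + 1 / 2 * (η / P.pComm κs) ^ 2 *
        ∑ i, (P.σ i)⁻¹ * ‖∑ e, P.aComm i e • P.commGrad s.θ (Sum.inl e)‖ ^ 2 := by
  have h1 : P.qA (s.lam - (η / P.pComm κs) • P.commGrad s.θ) = P.qA s.lam -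
      η / P.pComm κs * ‖P.commGrad s.θ‖ ^ 2 + 1 / 2 * (η / P.pComm κs) ^ 2 *
        ∑ i, (P.σ i)⁻¹ * ‖∑ e, P.aComm i e • P.commGrad s.θ (Sum.inl e)‖ ^ 2 := by
    rw [← real_inner_self_eq_norm_sq (P.commGrad s.θ), inner_commGrad]
    simp only [qA, Finset.mul_sum, ← Finset.sum_sub_distrib, ← Finset.sum_add_distrib]
    refine Finset.sum_congr rfl fun i _ => ?_
    rw [map_sub, map_smul, PiLp.sub_apply, PiLp.smul_apply, augA_commGrad_inl, norm_sub_sq_real,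
      norm_smul, mul_pow, Real.norm_eq_abs, sq_abs, inner_smul_right, hs i, inner_smul_left,
      RCLike.conj_to_real]
    ring
  rw [State.dualCost, step_comm_lam hs, h1, State.dualCost]
  change _ + ∑ i, ∑ j, conjGrad (P.f i j) (s.z i j) = _
  ring

/-- The effect of a communication on the Lyapunov quantity. -/
theorem lyapunov_step_comm_le (hP : P.Admissible) (hκ : P.IsStochasticCondition κs)
    (hη0 : 0 < η) (hη : η ≤ P.stepSize κs)
    (hc : ∀ i j, fenchel (P.f i j) (P.augA lamStar (Sum.inr (i, j))) = c i j)
    {s : P.State} (hs : s.Consistent) :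
    P.lyapunov κs η lamStar (P.step κs η s Draw.comm) ≤
      P.lyapunov κs η lamStar s + P.pMin κs / P.pComm κs * commLin lamStar s := by
  have hp := pComm_pos hP hκ
  have hq := pMin_pos hP hκ
  rw [lyapunov_eq hP hc, lyapunov_eq hP hc, dualCost_step_comm hs]
  change P.pMin κs / η * (_ + P.alpha⁻¹ * ∑ i, ∑ j,
        conjDiv (P.f i j) (c i j) (P.augA lamStar (Sum.inr (i, j))) (s.z i j)) + _ ≤ _
  have h1 : ‖P.pinvA (P.commPart (lamStar - (P.step κs η s Draw.comm).lam))‖ ^ 2 =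
      ‖P.pinvA (P.commPart (lamStar - s.lam))‖ ^ 2 + 2 * (η / P.pComm κs) * commLin lamStar s +
        (η / P.pComm κs) ^ 2 * ‖P.commGrad s.θ‖ ^ 2 := by
    have h2 : P.pinvA (P.commPart (lamStar - (P.step κs η s Draw.comm).lam)) =
        P.pinvA (P.commPart (lamStar - s.lam)) + (η / P.pComm κs) • P.commGrad s.θ := by
      rw [step_comm_lam hs, sub_sub_eq_add_sub, add_comm lamStar, add_sub_assoc]
      have h3 : ∀ a : P.DualVar, P.commPart ((η / P.pComm κs) • P.commGrad s.θ + a) =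
          (η / P.pComm κs) • P.commGrad s.θ + P.commPart a := by
        intro a
        ext k : 1
        rcases k with e | ij
        · rfl
        · change (0 : Vec d) = (η / P.pComm κs) • 0 + 0
          rw [smul_zero, add_zero]
      rw [h3, map_add, map_smul, pinvA_commGrad, add_comm]
    rw [h2, norm_add_sq_real, norm_smul, mul_pow, Real.norm_eq_abs, sq_abs, inner_smul_right,
      inner_pinvA_left, pinvA_commGrad, commLin, real_inner_comm, inner_commGrad_commPart]
    ring
  rw [h1]
  have h4 := sum_norm_sq_aComm_le (P.commGrad s.θ)
  rw [← norm_commGrad_sq] at h4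
  set a := η / P.pComm κs with ha
  have ha0 : 0 < a := div_pos hη0 hp
  have h5 : a * P.commSmooth ≤ 1 := by
    rw [ha, div_mul_eq_mul_div, div_le_one hp]
    exact mul_commSmooth_le hP hη
  set g := ‖P.commGrad s.θ‖ ^ 2
  have hg : 0 ≤ g := sq_nonneg _
  set G := ∑ i, (P.σ i)⁻¹ * ‖∑ e, P.aComm i e • P.commGrad s.θ (Sum.inl e)‖ ^ 2
  have h6 : a ^ 2 * G ≤ a * g := by
    calc a ^ 2 * G ≤ a ^ 2 * (P.commSmooth * g) := mul_le_mul_of_nonneg_left h4 (sq_nonneg a)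
      _ = (a * P.commSmooth) * (a * g) := by ring
      _ ≤ 1 * (a * g) := mul_le_mul_of_nonneg_right h5 (mul_nonneg ha0.le hg)
      _ = a * g := one_mul _
  -- the decrease of the dual cost pays for the quadratic term, because `p_min ≤ p_comm`
  have h7 : P.pMin κs / η * a = P.pMin κs / P.pComm κs := by
    rw [ha]; field_simp
  have h8 : P.pMin κs / P.pComm κs ≤ 1 := (div_le_one hp).mpr pMin_le_pComm
  have h9 : P.pMin κs / η * (1 / 2 * (a ^ 2 * g)) ≤ 1 / 2 * (a * g) := by
    calc P.pMin κs / η * (1 / 2 * (a ^ 2 * g)) = (P.pMin κs / η * a) * (1 / 2 * (a * g)) := by ring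
      _ ≤ 1 * (1 / 2 * (a * g)) := by
        rw [h7]
        exact mul_le_mul_of_nonneg_right h8 (by positivity)
      _ = _ := one_mul _
  have h10 : P.pMin κs / η * (a * commLin lamStar s) =
      P.pMin κs / P.pComm κs * commLin lamStar s := by rw [← mul_assoc, h7]
  linarith

/-- One update of a virtual parameter, with `κ = α η / p_{ij}`: the first bound is the three-point
inequality of a mirror step, the second one is descent. -/
theorem comp_update_bounds (hP : P.Admissible) {i : Fin n} {j : Fin m} {u z θ : Vec d} {c κ : ℝ}
    (hκ0 : 0 < κ) (hκ1 : κ * (1 + P.L i j / P.σ i) ≤ 1) {z' : Vec d}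
    (hz' : z' = (1 - κ) • z + κ • θ) {F : ℝ}
    (hF : F = -inner ℝ θ (gradient (P.f i j) z' - gradient (P.f i j) z) +
      1 / 2 * (P.σ i)⁻¹ * ‖gradient (P.f i j) z' - gradient (P.f i j) z‖ ^ 2 +
      (conjGrad (P.f i j) z' - conjGrad (P.f i j) z)) :
    conjDiv (P.f i j) c u z' - conjDiv (P.f i j) c u z ≤
      κ * (inner ℝ (z - θ) (u - gradient (P.f i j) z) - F) ∧ F ≤ 0 := by
  have hL := hP.L_pos i j
  have hσ := hP.σ_pos i
  have hfen := fun w => fenchel_gradient (hP.convex i j) (hP.diff i j) w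
  have e1 := le_conjDiv hP (hfen z') z
  have e2 := le_conjDiv hP (hfen z) z'
  rw [conjDiv] at e1 e2
  have hu' : u - gradient (P.f i j) z' = (u - gradient (P.f i j) z) -
    (gradient (P.f i j) z' - gradient (P.f i j) z) := by abel
  have hn : gradient (P.f i j) z - gradient (P.f i j) z' =
    -(gradient (P.f i j) z' - gradient (P.f i j) z) := by abel
  rw [hn, norm_neg, inner_neg_right] at e2
  set δ := gradient (P.f i j) z' - gradient (P.f i j) z
  have hz : ∀ w, inner ℝ z' w = inner ℝ z w - κ * inner ℝ (z - θ) w := by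
    intro w
    rw [hz', inner_add_left, inner_smul_left, inner_smul_left, inner_sub_left]
    simp only [RCLike.conj_to_real]
    ring
  have hd : inner ℝ (z - θ) δ = inner ℝ z δ - inner ℝ θ δ := inner_sub_left _ _ _
  have h0 : 0 ≤ 1 / (2 * P.L i j) * ‖δ‖ ^ 2 := by positivity
  set E := conjGrad (P.f i j) z' - conjGrad (P.f i j) z - inner ℝ z δ with hE
  have h1 : 1 / 2 * (P.σ i)⁻¹ * ‖δ‖ ^ 2 ≤ P.L i j / P.σ i * E := by
    have := mul_le_mul_of_nonneg_left e1 (div_pos hL hσ).le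
    refine le_trans (le_of_eq ?_) this
    field_simp
  have h2 : κ * (1 / 2 * (P.σ i)⁻¹ * ‖δ‖ ^ 2 + E) ≤ E := by
    calc κ * (1 / 2 * (P.σ i)⁻¹ * ‖δ‖ ^ 2 + E) ≤ κ * (P.L i j / P.σ i * E + E) :=
          mul_le_mul_of_nonneg_left (by linarith) hκ0.le
      _ = κ * (1 + P.L i j / P.σ i) * E := by ring
      _ ≤ 1 * E := mul_le_mul_of_nonneg_right hκ1 (h0.trans e1)
      _ = E := one_mul E
  rw [hz] at e2
  have hF' : F = inner ℝ (z - θ) δ + 1 / 2 * (P.σ i)⁻¹ * ‖δ‖ ^ 2 + E := by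
    rw [hF, hE, hd]; ring
  constructor
  · rw [conjDiv, conjDiv, hu', inner_sub_right z', hz, hz, hF']
    linarith
  · have h3 : κ * F ≤ 0 := by
      rw [hF']
      linarith
    by_contra! hpos
    exact absurd h3 (not_le.mpr (mul_pos hκ0 hpos))

end Problem

end DVR


namespace DVR

namespace Problem

variable {n m d : ℕ} {P : Problem n m d} {κs : ℝ} {lamStar : P.DualVar} {c : Fin n → Fin m → ℝ}
  {η : ℝ}

theorem sum_step_comp_z (s : P.State) (J : Fin n → Fin m) (i : Fin n) (g : Fin m → Vec d → ℝ) :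
    ∑ j, g j ((P.step κs η s (Draw.comp J)).z i j) = ∑ j, g j (s.z i j) +
      (g (J i) ((P.step κs η s (Draw.comp J)).z i (J i)) - g (J i) (s.z i (J i))) := by
  rw [← sub_eq_iff_eq_add', ← Finset.sum_sub_distrib]
  refine Finset.sum_eq_single (J i) (fun j _ hj => ?_) (fun hj => absurd (Finset.mem_univ _) hj)
  simp [step, hj]

/-- The effect of a computation step on the Lyapunov quantity. -/
theorem lyapunov_step_comp_le (hP : P.Admissible) (hκ : P.IsStochasticCondition κs)
    (hη0 : 0 < η) (hη : η ≤ P.stepSize κs)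
    (hc : ∀ i j, fenchel (P.f i j) (P.augA lamStar (Sum.inr (i, j))) = c i j)
    {s : P.State} (hs : s.Consistent) (J : Fin n → Fin m) :
    P.lyapunov κs η lamStar (P.step κs η s (Draw.comp J)) ≤
      P.lyapunov κs η lamStar s +
        ∑ i, P.pMin κs / P.pComp κs i (J i) * compLin lamStar s i (J i) := by
  have hs' := hs.step (κs := κs) (η := η) hP (Draw.comp J)
  set s' := P.step κs η s (Draw.comp J) with hs'_def
  have hx : P.commPart (lamStar - s'.lam) = P.commPart (lamStar - s.lam) := by
    have : P.commPart s'.lam = P.commPart s.lam := by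
      ext k : 1
      rcases k with e | ij <;> rfl
    rw [commPart_sub, commPart_sub, this]
  let δ : Fin n → Vec d := fun i =>
    gradient (P.f i (J i)) (s'.z i (J i)) - gradient (P.f i (J i)) (s.z i (J i))
  have hθ : ∀ i, s'.θ i = s.θ i - (P.σ i)⁻¹ • δ i := by
    intro i
    simp [δ, hs'_def, step]
  let F : Fin n → ℝ := fun i => -inner ℝ (s.θ i) (δ i) + 1 / 2 * (P.σ i)⁻¹ * ‖δ i‖ ^ 2 +
      (conjGrad (P.f i (J i)) (s'.z i (J i)) - conjGrad (P.f i (J i)) (s.z i (J i)))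
  have hcost : s'.dualCost = s.dualCost + ∑ i, F i := by
    rw [State.dualCost, State.dualCost, hs'.qA_lam hP, hs.qA_lam hP, Finset.mul_sum, Finset.mul_sum,
      ← Finset.sum_add_distrib, ← Finset.sum_add_distrib, ← Finset.sum_add_distrib]
    refine Finset.sum_congr rfl fun i _ => ?_
    have hσ := hP.σ_pos i
    rw [sum_step_comp_z s J i (fun j z => conjGrad (P.f i j) z), hθ, norm_sub_sq_real, norm_smul,
      mul_pow, Real.norm_eq_abs, sq_abs, inner_smul_right]
    simp only [F, hs'_def]
    field_simp
    ring
  have hdiv : ∑ i, ∑ j,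
        conjDiv (P.f i j) (c i j) (P.augA lamStar (Sum.inr (i, j))) (s'.z i j) =
      ∑ i, ∑ j, conjDiv (P.f i j) (c i j) (P.augA lamStar (Sum.inr (i, j))) (s.z i j) +
      ∑ i, (conjDiv (P.f i (J i)) (c i (J i)) (P.augA lamStar (Sum.inr (i, J i))) (s'.z i (J i)) -
        conjDiv (P.f i (J i)) (c i (J i)) (P.augA lamStar (Sum.inr (i, J i))) (s.z i (J i))) := by
    rw [← Finset.sum_add_distrib]
    exact Finset.sum_congr rfl fun i _ => sum_step_comp_z s J i fun j z =>
      conjDiv (P.f i j) (c i j) (P.augA lamStar (Sum.inr (i, j))) z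
  have hα := hP.alpha_pos
  have hpm := pMin_pos hP hκ
  have hnode : ∀ i, P.pMin κs / η * (P.alpha⁻¹ *
      (conjDiv (P.f i (J i)) (c i (J i)) (P.augA lamStar (Sum.inr (i, J i))) (s'.z i (J i)) -
        conjDiv (P.f i (J i)) (c i (J i)) (P.augA lamStar (Sum.inr (i, J i))) (s.z i (J i)))) + F i
      ≤ P.pMin κs / P.pComp κs i (J i) * compLin lamStar s i (J i) := by
    intro i
    have hp := pComp_pos hP hκ i (J i)
    have hk : P.alpha * η / P.pComp κs i (J i) * (1 + P.L i (J i) / P.σ i) ≤ 1 := by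
      rw [div_mul_eq_mul_div, div_le_one hp]
      exact alpha_mul_le hP hη i (J i)
    obtain ⟨b1, b2⟩ := comp_update_bounds hP (u := P.augA lamStar (Sum.inr (i, J i)))
      (c := c i (J i)) (z := s.z i (J i)) (θ := s.θ i) (z' := s'.z i (J i))
      (div_pos (mul_pos hα hη0) hp) hk (by simp [hs'_def, step]) (F := F i) rfl
    have h1 := mul_le_mul_of_nonneg_left b1
      (mul_pos (div_pos hpm hη0) (inv_pos.mpr hα)).le
    have h2 : P.pMin κs / P.pComp κs i (J i) ≤ 1 := (div_le_one hp).mpr (pMin_le_pComp i (J i))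
    have h3 : P.pMin κs / η * P.alpha⁻¹ * (P.alpha * η / P.pComp κs i (J i) *
        (inner ℝ (s.z i (J i) - s.θ i) (P.augA lamStar (Sum.inr (i, J i)) -
          gradient (P.f i (J i)) (s.z i (J i))) - F i)) =
        P.pMin κs / P.pComp κs i (J i) * compLin lamStar s i (J i) -
          P.pMin κs / P.pComp κs i (J i) * F i := by
      rw [compLin]
      field_simp
    -- `F i ≤ 0` and `p_min ≤ p_{ij}`
    have h4 : F i ≤ P.pMin κs / P.pComp κs i (J i) * F i := by
      nlinarith
    rw [h3] at h1
    linarith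
  have hsum := Finset.sum_le_sum fun i (_ : i ∈ Finset.univ) => hnode i
  rw [Finset.sum_add_distrib, ← Finset.mul_sum, ← Finset.mul_sum] at hsum
  rw [lyapunov_eq hP hc, lyapunov_eq hP hc, hx, hcost, hdiv]
  linarith

/-! ### Relative strong convexity -/

/-- The linear terms of all blocks add up to `⟨∇F(λ), λ⋆ - λ⟩ = F(λ⋆) - F(λ) - D_F(λ⋆, λ)` for the dual
cost `F`: the divergence of a quadratic form is the form itself. -/
theorem sum_linear_terms (hP : P.Admissible)
    {s : P.State} (hs : s.Consistent) :
    commLin lamStar s + ∑ i, ∑ j, compLin lamStar s i j =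
      -(s.dualCost - (P.qA lamStar + ∑ i, ∑ j, c i j)) - P.qA (s.lam - lamStar) -
        ∑ i, ∑ j, conjDiv (P.f i j) (c i j) (P.augA lamStar (Sum.inr (i, j))) (s.z i j) := by
  have h1 : ∀ i, ∑ j, compLin lamStar s i j =
      ∑ j, inner ℝ (s.z i j) (P.augA lamStar (Sum.inr (i, j)) - gradient (P.f i j) (s.z i j)) -
        inner ℝ (s.θ i) (∑ j, P.augA (lamStar - s.lam) (Sum.inr (i, j))) := by
    intro i
    rw [inner_sum, ← Finset.sum_sub_distrib]
    simp only [compLin, inner_sub_left, map_sub, PiLp.sub_apply, augA_lam_inr hP]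
  have h2 : P.qA lamStar = P.qA s.lam + ∑ i, inner ℝ (s.θ i)
      (P.augA (lamStar - s.lam) (Sum.inl i)) + P.qA (s.lam - lamStar) := by
    simp only [qA, Finset.mul_sum, ← Finset.sum_add_distrib]
    refine Finset.sum_congr rfl fun i _ => ?_
    rw [hs i, inner_smul_left, map_sub, map_sub, PiLp.sub_apply, PiLp.sub_apply, norm_sub_sq_real,
      inner_sub_right, real_inner_self_eq_norm_sq]
    simp only [RCLike.conj_to_real]
    ring
  rw [commLin, inner_commGrad]
  simp only [← augA_inl_add_sum_inr, h1, inner_add_right, Finset.sum_add_distrib,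
    Finset.sum_sub_distrib, conjDiv, State.dualCost]
  linarith

/-- Minimization over the split of `A` between a node (curvature `σ`) and its components
(curvature `Λ`), by the Cauchy-Schwarz inequality. -/
theorem sq_le_of_split {σ Λ u v p q N A : ℝ} (hσ : 0 < σ) (hu : 0 < u) (hv : 0 < v)
    (hΛ : 0 ≤ Λ) (hp : 0 ≤ p) (hq : 0 ≤ q) (hA : 0 ≤ A) (hN : 0 ≤ N) (hqN : q ^ 2 ≤ Λ * N)
    (hApq : A ≤ p + q) : A ^ 2 ≤ (σ / u + Λ / v) * (u * (σ⁻¹ * p ^ 2) + v * N) := by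
  have h1 : A ^ 2 ≤ (p + q) ^ 2 := pow_le_pow_left₀ hA hApq 2
  set X := Λ / v * (u * (σ⁻¹ * p ^ 2)) with hX
  set Y := σ / u * (v * N) with hY
  have hX0 : 0 ≤ X := by positivity
  have hY0 : 0 ≤ Y := by positivity
  have hXY : X * Y = p ^ 2 * (Λ * N) := by rw [hX, hY]; field_simp
  have h2 : (2 * p * q) ^ 2 ≤ (X + Y) ^ 2 := by
    have : p ^ 2 * q ^ 2 ≤ p ^ 2 * (Λ * N) := mul_le_mul_of_nonneg_left hqN (sq_nonneg p)
    nlinarith [sq_nonneg (X - Y)]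
  have h3 : 2 * p * q ≤ X + Y := (sq_le_sq₀ (by positivity) (by positivity)).mp h2
  have h4 : (σ / u + Λ / v) * (u * (σ⁻¹ * p ^ 2) + v * N) = p ^ 2 + X + Y + Λ * N := by
    rw [hX, hY]; field_simp; ring
  nlinarith

theorem coef_mul_sq_le_of_split {σ Λ u v p q N A K : ℝ} (hσ : 0 < σ) (hu : 0 < u) (hv : 0 < v)
    (hΛ : 0 ≤ Λ) (hp : 0 ≤ p) (hq : 0 ≤ q) (hA : 0 ≤ A) (hN : 0 ≤ N) (hqN : q ^ 2 ≤ Λ * N)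
    (hApq : A ≤ p + q) (hK : K * (σ / u + Λ / v) ≤ 1) :
    K * A ^ 2 ≤ u * (σ⁻¹ * p ^ 2) + v * N := by
  have hR : 0 ≤ u * (σ⁻¹ * p ^ 2) + v * N := by positivity
  rcases le_total K 0 with h | h
  · exact (mul_nonpos_of_nonpos_of_nonneg h (sq_nonneg A)).trans hR
  · have h1 := mul_le_mul_of_nonneg_left
      (sq_le_of_split hσ hu hv hΛ hp hq hA hN hqN hApq) h
    calc K * A ^ 2 ≤ K * (σ / u + Λ / v) * (u * (σ⁻¹ * p ^ 2) + v * N) := by linarith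
      _ ≤ 1 * (u * (σ⁻¹ * p ^ 2) + v * N) := mul_le_mul_of_nonneg_right hK hR
      _ = _ := one_mul _

/-- The tangent-line bound used when the communication is the rarest event: as a function of
`y = σ / (σ + Λ)`, the coefficient `1 / (σ / (2 - t) + Λ / (3 / 2 - t))` is convex, and it is bounded
below by an affine function whose value at `y = t` is `t / σ`. -/
theorem tangent_coef_le {σ Λ t : ℝ} (hσ : 0 < σ) (hΛ : 0 ≤ Λ) (h0 : 0 ≤ t) (h1 : t ≤ 1) :
    ((1 + (1 + t) / 2) * (σ + Λ)⁻¹ - (1 + t) / 2 * t * σ⁻¹) * (σ / (2 - t) + Λ / (3 / 2 - t)) ≤ 1 := by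
  have hu : 0 < 2 - t := by linarith
  have hv : 0 < 3 / 2 - t := by linarith
  have hS : 0 < σ + Λ := by linarith
  obtain ⟨S, rfl⟩ : ∃ S, Λ = S - σ := ⟨σ + Λ, by ring⟩
  rw [add_sub_cancel] at hS ⊢
  have e : ((1 + (1 + t) / 2) * S⁻¹ - (1 + t) / 2 * t * σ⁻¹) *
      (σ / (2 - t) + (S - σ) / (3 / 2 - t)) =
      (((1 + (1 + t) / 2) * σ - (1 + t) / 2 * t * S) * (S * (2 - t) - σ / 2)) /
        (σ * S * ((2 - t) * (3 / 2 - t))) := by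
    have e1 : (1 + (1 + t) / 2) * S⁻¹ - (1 + t) / 2 * t * σ⁻¹ =
        ((1 + (1 + t) / 2) * σ - (1 + t) / 2 * t * S) / (σ * S) := by field_simp
    rw [e1, div_add_div _ _ hu.ne' hv.ne', div_mul_div_comm]
    congr 2
    ring
  rw [e, div_le_one (by positivity)]
  have h2 : 16 * (3 + t) * (σ * S * ((2 - t) * (3 / 2 - t)) -
      ((1 + (1 + t) / 2) * σ - (1 + t) / 2 * t * S) * (S * (2 - t) - σ / 2)) =
      (2 * (3 + t) * σ - t * (13 - 5 * t) * S) ^ 2 + t * (1 - t) ^ 2 * (48 - 33 * t) * S ^ 2 := by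
    ring
  have h3 : 0 ≤ t * (1 - t) ^ 2 * (48 - 33 * t) * S ^ 2 := by
    have : 0 ≤ 48 - 33 * t := by linarith
    positivity
  have h4 : 0 ≤ 16 * (3 + t) * (σ * S * ((2 - t) * (3 / 2 - t)) -
      ((1 + (1 + t) / 2) * σ - (1 + t) / 2 * t * S) * (S * (2 - t) - σ / 2)) := by
    rw [h2]; positivity
  have h5 := nonneg_of_mul_nonneg_right h4 (by linarith)
  linarith

theorem norm_pinvA_commPart_sq (hP : P.Admissible) (a : P.DualVar) :
    ‖P.pinvA (P.commPart a)‖ ^ 2 = ∑ e, ‖P.pinvA (P.commPart a) (Sum.inl e)‖ ^ 2 := by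
  rw [← real_inner_self_eq_norm_sq, inner_dualVar]
  simp only [pinvA_commPart_inr hP, inner_zero_left, Finset.sum_const_zero, add_zero,
    real_inner_self_eq_norm_sq]

/-- The strong convexity of the dual cost relative to `φ`, restricted to the communication
coordinates. The weights on the right-hand side exceed those of a divergence of the dual cost by the
part `1 - t` of the dual gap that the contraction does not need. -/
theorem commConvex_mul_norm_sq_le (hP : P.Admissible) {s : P.State} {t : ℝ} (h0 : 0 ≤ t)
    (h1 : t ≤ 1) (ht : t ≤ 1 / 2 ∨ t * P.commSmooth ≤ P.commConvex) :
    P.commConvex / 2 * ‖P.pinvA (P.commPart (lamStar - s.lam))‖ ^ 2 ≤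
      (2 - t) * P.qA (s.lam - lamStar) + (3 / 2 - t) * P.gradDist lamStar s := by
  set Δ := lamStar - s.lam with hΔ
  let a : Fin n → Vec d := fun i => ∑ e, P.aComm i e • Δ (Sum.inl e)
  have hu : 0 < 2 - t := by linarith
  have hv : 0 < 3 / 2 - t := by linarith
  have hR : 2 * ((2 - t) * P.qA (s.lam - lamStar) + (3 / 2 - t) * P.gradDist lamStar s) =
      ∑ i, ((2 - t) * ((P.σ i)⁻¹ * ‖P.augA Δ (Sum.inl i)‖ ^ 2) +
        (3 / 2 - t) * ∑ j, ‖P.augA Δ (Sum.inr (i, j))‖ ^ 2 / P.L i j) := by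
    have e1 : P.qA (s.lam - lamStar) = 1 / 2 * ∑ i, (P.σ i)⁻¹ * ‖P.augA Δ (Sum.inl i)‖ ^ 2 := by
      rw [qA]
      congr 1
      refine Finset.sum_congr rfl fun i _ => ?_
      rw [hΔ, ← neg_sub lamStar, map_neg, PiLp.neg_apply, norm_neg]
    have e2 : P.gradDist lamStar s =
        1 / 2 * ∑ i, ∑ j, ‖P.augA Δ (Sum.inr (i, j))‖ ^ 2 / P.L i j := by
      rw [gradDist]
      simp only [Finset.mul_sum]
      refine Finset.sum_congr rfl fun i _ => Finset.sum_congr rfl fun j _ => ?_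
      have := (hP.L_pos i j).ne'
      rw [hΔ, map_sub, PiLp.sub_apply, augA_lam_inr hP, norm_sub_rev]
      field_simp
    rw [e1, e2, Finset.sum_add_distrib, ← Finset.mul_sum, ← Finset.mul_sum]
    ring
  have hnode : ∀ (K : Fin n → ℝ), (∀ i, K i * (P.σ i / (2 - t) + P.nodeSmooth i / (3 / 2 - t)) ≤ 1) →
      ∑ i, K i * ‖a i‖ ^ 2 ≤
        2 * ((2 - t) * P.qA (s.lam - lamStar) + (3 / 2 - t) * P.gradDist lamStar s) := by
    intro K hK
    rw [hR]
    refine Finset.sum_le_sum fun i _ => ?_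
    refine coef_mul_sq_le_of_split (hP.σ_pos i) hu hv (hP.nodeSmooth_nonneg i) (norm_nonneg _)
      (norm_nonneg (∑ j, P.augA Δ (Sum.inr (i, j)))) (norm_nonneg _)
      (Finset.sum_nonneg fun j _ => div_nonneg (sq_nonneg _) (hP.L_pos i j).le)
      (hP.norm_sum_sq_le i fun j => proj_augA_inr Δ i j) ?_ (hK i)
    simp only [a]
    rw [← augA_inl_add_sum_inr]
    exact norm_add_le _ _
  have hlow := commConvex_mul_norm_pinvA_le hP Δ
  set N := ‖P.pinvA (P.commPart Δ)‖ ^ 2 with hN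
  rcases ht with ht | ht
  · have h2 := hnode (fun i => (P.σ i + P.nodeSmooth i)⁻¹) fun i => by
      have hσ := hP.σ_pos i
      have hΛ := hP.nodeSmooth_nonneg i
      rw [inv_mul_le_iff₀ (by linarith), mul_one]
      exact add_le_add (div_le_self hσ.le (by linarith)) (div_le_self hΛ (by linarith))
    linarith
  · have hup := sum_norm_sq_aComm_le (P.pinvA (P.commPart Δ))
    simp only [sum_aComm_pinvA hP] at hup
    rw [← norm_pinvA_commPart_sq hP, ← hN] at hup
    have h2 := hnode (fun i => (1 + (1 + t) / 2) * (P.σ i + P.nodeSmooth i)⁻¹ -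
      (1 + t) / 2 * t * (P.σ i)⁻¹)
      fun i => tangent_coef_le (hP.σ_pos i) (hP.nodeSmooth_nonneg i) h0 h1
    simp only [sub_mul, mul_assoc, Finset.sum_sub_distrib, ← Finset.mul_sum] at h2
    have hN0 : 0 ≤ N := sq_nonneg _
    have h3 := mul_le_mul_of_nonneg_left hup h0
    have h4 := mul_le_mul_of_nonneg_right ht hN0
    have h5 : t * ∑ i, (P.σ i)⁻¹ * ‖a i‖ ^ 2 ≤ P.commConvex * N := by linarith
    have h6 := mul_le_mul_of_nonneg_left h5 (by linarith : 0 ≤ (1 + t) / 2)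
    have h7 := mul_le_mul_of_nonneg_left hlow (by linarith : 0 ≤ 1 + (1 + t) / 2)
    linarith

end Problem

end DVR

/-! ### Contraction in expectation over one draw -/

namespace DVR

theorem Draw.sum_eq {n m : ℕ} (g : Draw n m → ℝ) :
    ∑ e, g e = g Draw.comm + ∑ J, g (Draw.comp J) := by
  rw [← Fintype.sum_equiv (Draw.equivOption n m) (fun o => g (Draw.equivOption n m o)) g
    fun _ => rfl, Fintype.sum_option]
  rfl

/-- The expectation of `h (J i₀)` when the coordinates of `J` are independent. -/
theorem sum_prod_mul_apply {ι κ : Type*} [Fintype ι] [DecidableEq ι] [Fintype κ]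
    (q : ι → κ → ℝ) (hq : ∀ i, ∑ j, q i j = 1) (i₀ : ι) (h : κ → ℝ) :
    ∑ J : ι → κ, (∏ i, q i (J i)) * h (J i₀) = ∑ j, q i₀ j * h j := by
  have h1 : ∀ J : ι → κ, (∏ i, q i (J i)) * h (J i₀) =
      ∏ i, q i (J i) * (if i = i₀ then h (J i) else 1) := by
    intro J
    rw [Finset.prod_mul_distrib]
    simp
  simp_rw [h1]
  rw [← Fintype.prod_sum (fun i j => q i j * if i = i₀ then h j else 1),
    Finset.prod_eq_single i₀ (fun i _ hi => by simp [hi, hq]) (by simp)]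
  simp

theorem sum_prod_eq_one {ι κ : Type*} [Fintype ι] [DecidableEq ι] [Fintype κ]
    (q : ι → κ → ℝ) (hq : ∀ i, ∑ j, q i j = 1) : ∑ J : ι → κ, ∏ i, q i (J i) = 1 := by
  rw [← Fintype.prod_sum]
  simp [hq]

namespace Problem

variable {n m d : ℕ} {P : Problem n m d} {κs : ℝ} {lamStar : P.DualVar} {c : Fin n → Fin m → ℝ}
  {η : ℝ}

section

variable (hP : P.Admissible) (hκ : P.IsStochasticCondition κs)
include hP hκ

theorem sum_pComp_div (i : Fin n) : ∑ j, P.pComp κs i j / (1 - P.pComm κs) = 1 := by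
  rw [← Finset.sum_div, sum_pComp hP, div_self (sub_pos.mpr (pComm_lt_one hP hκ)).ne']

theorem drawProb_nonneg (e : Draw n m) : 0 ≤ P.drawProb κs e := by
  have h1 := sub_pos.mpr (pComm_lt_one hP hκ)
  cases e with
  | comm => exact (pComm_pos hP hκ).le
  | comp J =>
    exact mul_nonneg h1.le
      (Finset.prod_nonneg fun i _ => div_nonneg (pComp_pos hP hκ i _).le h1.le)

theorem sum_drawProb_comp : ∑ J, P.drawProb κs (Draw.comp J) = 1 - P.pComm κs := by
  simp only [drawProb]
  rw [← Finset.mul_sum, sum_prod_eq_one (fun i j => P.pComp κs i j / (1 - P.pComm κs))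
    (sum_pComp_div hP hκ), mul_one]

theorem sum_drawProb_comp_mul (h : Fin n → Fin m → ℝ) :
    ∑ J, P.drawProb κs (Draw.comp J) * ∑ i, h i (J i) = ∑ i, ∑ j, P.pComp κs i j * h i j := by
  have h1 := (sub_pos.mpr (pComm_lt_one hP hκ)).ne'
  simp only [drawProb, mul_assoc, ← Finset.mul_sum]
  simp only [Finset.mul_sum]
  rw [Finset.sum_comm]
  refine Finset.sum_congr rfl fun i _ => ?_
  rw [← Finset.mul_sum, sum_prod_mul_apply (fun i j => P.pComp κs i j / (1 - P.pComm κs))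
    (sum_pComp_div hP hκ) i (h i), Finset.mul_sum]
  refine Finset.sum_congr rfl fun j _ => ?_
  field_simp

/-- The contraction of the Lyapunov quantity in conditional expectation. -/
theorem sum_drawProb_mul_lyapunov_le (hη0 : 0 < η) (hη : η ≤ P.stepSize κs)
    (hstar : ∀ lam, P.dualObj lam ≤ P.dualObj lamStar) {s : P.State} (hs : s.Consistent) :
    ∑ e, P.drawProb κs e * P.lyapunov κs η lamStar (P.step κs η s e) ≤
      (1 - P.alpha * η / 2) * P.lyapunov κs η lamStar s := by
  obtain ⟨c, hc⟩ := exists_fenchel_eq_coe hP hstar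
  have hp := pComm_pos hP hκ
  have hpm := pMin_pos hP hκ
  have hα := hP.alpha_pos
  set ℓ := P.lyapunov κs η lamStar s with hℓ
  have h1 : ∑ e, P.drawProb κs e * P.lyapunov κs η lamStar (P.step κs η s e) ≤
      ℓ + P.pMin κs * (commLin lamStar s + ∑ i, ∑ j, compLin lamStar s i j) := by
    rw [Draw.sum_eq]
    have a1 := mul_le_mul_of_nonneg_left (lyapunov_step_comm_le hP hκ hη0 hη hc hs)
      (drawProb_nonneg hP hκ Draw.comm)
    have a2 := Finset.sum_le_sum fun J (_ : J ∈ Finset.univ) => mul_le_mul_of_nonneg_left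
      (lyapunov_step_comp_le hP hκ hη0 hη hc hs J) (drawProb_nonneg hP hκ (Draw.comp J))
    simp only [mul_add, Finset.sum_add_distrib] at a2
    rw [← Finset.sum_mul, sum_drawProb_comp hP hκ, sum_drawProb_comp_mul hP hκ
      (fun i j => P.pMin κs / P.pComp κs i j * compLin lamStar s i j)] at a2
    have a3 : ∑ i, ∑ j, P.pComp κs i j * (P.pMin κs / P.pComp κs i j * compLin lamStar s i j) =
        P.pMin κs * ∑ i, ∑ j, compLin lamStar s i j := by
      simp only [Finset.mul_sum]
      refine Finset.sum_congr rfl fun i _ => Finset.sum_congr rfl fun j _ => ?_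
      have := (pComp_pos hP hκ i j).ne'
      field_simp
    have a4 : P.drawProb κs Draw.comm * (ℓ + P.pMin κs / P.pComm κs * commLin lamStar s) =
        P.pComm κs * ℓ + P.pMin κs * commLin lamStar s := by
      simp only [drawProb]
      field_simp
    rw [a4] at a1
    rw [a3] at a2
    linarith
  refine h1.trans ?_
  rw [sum_linear_terms hP hs (c := c)]
  -- the relative strong convexity, with `t = α η / (2 p_min)`
  set t := P.alpha * η / (2 * P.pMin κs) with ht
  have ht0 : 0 ≤ t := by positivity
  have hdich := ratio_dichotomy hP hη hκ hη0
  rw [← ht] at hdich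
  have ht1 : t ≤ 1 := by
    rcases hdich with h | h
    · linarith
    · refine le_of_mul_le_mul_right ?_ hP.commSmooth_pos
      rw [one_mul]
      exact h.trans hP.commConvex_le_commSmooth
  have hmain := commConvex_mul_norm_sq_le (lamStar := lamStar) hP (s := s) ht0 ht1 hdich
  have hgrow := qA_add_gradDist_le hP hc hstar s
  have hdiv : P.gradDist lamStar s ≤
      ∑ i, ∑ j, conjDiv (P.f i j) (c i j) (P.augA lamStar (Sum.inr (i, j))) (s.z i j) :=
    Finset.sum_le_sum fun i _ => Finset.sum_le_sum fun j _ => by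
      rw [norm_sub_rev]
      exact le_conjDiv hP (hc i j) (s.z i j)
  have hℓeq := lyapunov_eq hP hc κs η s
  rw [← hℓ] at hℓeq
  set N := ‖P.pinvA (P.commPart (lamStar - s.lam))‖ ^ 2
  set B := ∑ i, ∑ j, conjDiv (P.f i j) (c i j) (P.augA lamStar (Sum.inr (i, j))) (s.z i j)
  set G := s.dualCost - (P.qA lamStar + ∑ i, ∑ j, c i j)
  have e1 : P.alpha * η / 2 * ℓ = P.pMin κs * (P.commConvex / 2 * N + 1 / 2 * B + t * G) := by
    have hcc : P.commConvex = P.alpha / 2 := by rw [alpha]; ring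
    rw [hℓeq, ht, hcc]
    field_simp
  have h5 := mul_le_mul_of_nonneg_left hgrow (sub_nonneg.mpr ht1)
  have h6 : P.commConvex / 2 * N + 1 / 2 * B + t * G ≤ G + P.qA (s.lam - lamStar) + B := by
    linarith
  have h7 := mul_le_mul_of_nonneg_left h6 hpm.le
  linarith

theorem lyapunov_nonneg (hη0 : 0 < η)
    (hstar : ∀ lam, P.dualObj lam ≤ P.dualObj lamStar) (s : P.State) :
    0 ≤ P.lyapunov κs η lamStar s := by
  obtain ⟨c, hc⟩ := exists_fenchel_eq_coe hP hstar
  have hpm := pMin_pos hP hκ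
  have hα := hP.alpha_pos
  have hgrow := qA_add_gradDist_le hP hc hstar s
  have h1 := gradDist_nonneg hP lamStar s
  have h2 := qA_nonneg hP (s.lam - lamStar)
  have h3 : 0 ≤ ∑ i, ∑ j, conjDiv (P.f i j) (c i j) (P.augA lamStar (Sum.inr (i, j))) (s.z i j) :=
    Finset.sum_nonneg fun i _ => Finset.sum_nonneg fun j _ => by
      have := hP.L_pos i j
      exact le_trans (by positivity) (le_conjDiv hP (hc i j) (s.z i j))
  rw [lyapunov_eq hP hc]
  refine add_nonneg ?_ (by linarith)
  positivity

theorem contraction_factor_mem (hη0 : 0 < η) (hη : η ≤ P.stepSize κs) :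
    0 < 1 - P.alpha * η / 2 ∧ 1 - P.alpha * η / 2 < 1 := by
  have h1 := commConvex_mul_le hP hη hη0
  have h2 := pComm_lt_one hP hκ
  have h3 := mul_pos hP.commConvex_pos hη0
  have h4 : P.alpha * η / 2 = P.commConvex * η := by rw [alpha]; ring
  constructor <;> linarith

end

/-! ### The process driven by independent draws -/

section Draws

variable {Ω : Type*} [MeasurableSpace Ω] {μ : Measure Ω} [IsProbabilityMeasure μ]
  {ξ : ℕ → Ω → Draw n m}

theorem State.Consistent.init (x₀ : Edge P.G → Vec d) (z₀ : Fin n → Fin m → Vec d) :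
    (P.init x₀ z₀).Consistent := fun _ => rfl

theorem State.Consistent.run (hP : P.Admissible) {s₀ : P.State} (hs : s₀.Consistent)
    (e : ℕ → Draw n m) (t : ℕ) : (P.run κs η s₀ e t).Consistent := by
  induction t with
  | zero => exact hs
  | succ t ih => exact ih.step hP (e t)

theorem run_congr (s₀ : P.State) {e e' : ℕ → Draw n m} {t : ℕ} (h : ∀ k < t, e k = e' k) :
    P.run κs η s₀ e t = P.run κs η s₀ e' t := by
  induction t with
  | zero => rfl
  | succ t ih =>
    rw [run, run, ih fun k hk => h k (hk.trans t.lt_succ_self), h t t.lt_succ_self]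

/-- Conditioning on the past: an inequality for the average over the next draw, valid for every
past, integrates. -/
theorem integral_next_le (hξ : ∀ t, Measurable (ξ t)) (hind : iIndepFun ξ μ) {p : Draw n m → ℝ}
    (hlaw : ∀ t e, μ.real {ω | ξ t ω = e} = p e) (t : ℕ)
    (g : (Finset.range t → Draw n m) → Draw n m → ℝ) (b : (Finset.range t → Draw n m) → ℝ)
    (hgb : ∀ y, ∑ e, p e * g y e ≤ b y) :
    ∫ ω, g (fun k => ξ k ω) (ξ t ω) ∂μ ≤ ∫ ω, b (fun k => ξ k ω) ∂μ := by
  have : MeasurableSingletonClass (Draw n m) := ⟨fun _ => trivial⟩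
  let Y : Ω → (Finset.range t → Draw n m) := fun ω k => ξ k ω
  have hY : Measurable Y := measurable_pi_lambda _ fun k => hξ k
  have hindep : IndepFun Y (ξ t) μ := by
    have h1 := hind.indepFun_finset (Finset.range t) {t} (by simp) hξ
    have h2 : Measurable fun v : ({t} : Finset ℕ) → Draw n m =>
      v ⟨t, Finset.mem_singleton_self t⟩ := measurable_pi_apply _
    exact h1.comp (φ := id) measurable_id h2
  have hmap := (indepFun_iff_map_prod_eq_prod_map_map hY.aemeasurable (hξ t).aemeasurable).mp hindep
  have : IsProbabilityMeasure (μ.map Y) := Measure.isProbabilityMeasure_map hY.aemeasurable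
  have : IsProbabilityMeasure (μ.map (ξ t)) := Measure.isProbabilityMeasure_map (hξ t).aemeasurable
  have hreal : ∀ e, (μ.map (ξ t)).real {e} = p e := by
    intro e
    rw [map_measureReal_apply (hξ t) (measurableSet_singleton e), ← hlaw t e]
    rfl
  calc ∫ ω, g (fun k => ξ k ω) (ξ t ω) ∂μ
      = ∫ v, g v.1 v.2 ∂(μ.map fun ω => (Y ω, ξ t ω)) :=
        (integral_map (f := fun v : (Finset.range t → Draw n m) × Draw n m => g v.1 v.2)
          (hY.prodMk (hξ t)).aemeasurable
          (measurable_of_countable _).aestronglyMeasurable).symm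
    _ = ∫ y, ∫ e, g y e ∂(μ.map (ξ t)) ∂(μ.map Y) := by
        rw [hmap, integral_prod _ (Integrable.of_finite)]
    _ ≤ ∫ y, b y ∂(μ.map Y) := by
        refine integral_mono Integrable.of_finite Integrable.of_finite fun y => ?_
        refine le_trans (le_of_eq ?_) (hgb y)
        rw [integral_fintype Integrable.of_finite]
        simp only [hreal, smul_eq_mul]
    _ = ∫ ω, b (fun k => ξ k ω) ∂μ :=
        integral_map hY.aemeasurable (measurable_of_countable _).aestronglyMeasurable

theorem integrable_comp_draws (hξ : ∀ t, Measurable (ξ t)) (t : ℕ)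
    (b : (Finset.range t → Draw n m) → ℝ) : Integrable (fun ω => b (fun k => ξ k ω)) μ := by
  have : MeasurableSingletonClass (Draw n m) := ⟨fun _ => trivial⟩
  have hY : Measurable fun ω (k : Finset.range t) => ξ k ω := measurable_pi_lambda _ fun k => hξ k
  exact (Integrable.of_finite (f := b) (μ := μ.map fun ω (k : Finset.range t) =>
    ξ k ω)).comp_measurable hY

/-- A sequence of draws with the given beginning. -/
def extendDraws {t : ℕ} (y : Finset.range t → Draw n m) : ℕ → Draw n m :=
  fun k => if h : k ∈ Finset.range t then y ⟨k, h⟩ else Draw.comm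

theorem run_extendDraws {Ω : Type*} {ξ : ℕ → Ω → Draw n m} (s₀ : P.State) (ω : Ω) (t : ℕ) :
    P.run κs η s₀ (extendDraws fun k : Finset.range t => ξ k ω) t =
      P.run κs η s₀ (fun k => ξ k ω) t :=
  run_congr s₀ fun k hk => by simp [extendDraws, hk]

theorem integrable_lyapunov_run (hξ : ∀ t, Measurable (ξ t)) (s₀ : P.State) (t : ℕ) :
    Integrable (fun ω => P.lyapunov κs η lamStar (P.run κs η s₀ (fun k => ξ k ω) t)) μ := by
  have h := integrable_comp_draws (μ := μ) hξ t fun y =>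
    P.lyapunov κs η lamStar (P.run κs η s₀ (extendDraws y) t)
  simpa only [run_extendDraws] using h

theorem integral_lyapunov_run_le (hP : P.Admissible) (hκ : P.IsStochasticCondition κs)
    (hη0 : 0 < η) (hη : η ≤ P.stepSize κs)
    (hstar : ∀ lam, P.dualObj lam ≤ P.dualObj lamStar)
    (hξ : ∀ t, Measurable (ξ t)) (hind : iIndepFun ξ μ)
    (hlaw : ∀ t e, μ.real {ω | ξ t ω = e} = P.drawProb κs e)
    {s₀ : P.State} (hs : s₀.Consistent) (t : ℕ) :
    ∫ ω, P.lyapunov κs η lamStar (P.run κs η s₀ (fun k => ξ k ω) t) ∂μ ≤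
      (1 - P.alpha * η / 2) ^ t * P.lyapunov κs η lamStar s₀ := by
  induction t with
  | zero => simp [run]
  | succ t ih =>
    have h1 := integral_next_le hξ hind hlaw t
      (fun y e => P.lyapunov κs η lamStar (P.step κs η (P.run κs η s₀ (extendDraws y) t) e))
      (fun y => (1 - P.alpha * η / 2) *
        P.lyapunov κs η lamStar (P.run κs η s₀ (extendDraws y) t))
      fun y => sum_drawProb_mul_lyapunov_le hP hκ hη0 hη hstar (hs.run hP _ t)
    simp only [run_extendDraws, integral_const_mul] at h1
    refine h1.trans ?_
    rw [pow_succ', mul_assoc]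
    exact mul_le_mul_of_nonneg_left ih (contraction_factor_mem hP hκ hη0 hη).1.le

theorem integral_sum_cost (hP : P.Admissible) (hκ : P.IsStochasticCondition κs)
    (hξ : ∀ t, Measurable (ξ t)) (hlaw : ∀ t e, μ.real {ω | ξ t ω = e} = P.drawProb κs e)
    (τ : ℝ) (K : ℕ) : ∫ ω, ∑ t ∈ Finset.range K, (ξ t ω).cost τ ∂μ =
      K * (P.pComm κs * τ + (1 - P.pComm κs)) := by
  have : MeasurableSingletonClass (Draw n m) := ⟨fun _ => trivial⟩
  have hint : ∀ t, Integrable (fun ω => (ξ t ω).cost τ) μ := fun t => by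
    have : IsProbabilityMeasure (μ.map (ξ t)) :=
      Measure.isProbabilityMeasure_map (hξ t).aemeasurable
    exact (Integrable.of_finite (f := Draw.cost τ) (μ := μ.map (ξ t))).comp_measurable (hξ t)
  have hone : ∀ t, ∫ ω, (ξ t ω).cost τ ∂μ = P.pComm κs * τ + (1 - P.pComm κs) := by
    intro t
    have : IsProbabilityMeasure (μ.map (ξ t)) :=
      Measure.isProbabilityMeasure_map (hξ t).aemeasurable
    have hreal : ∀ e, (μ.map (ξ t)).real {e} = P.drawProb κs e := by
      intro e
      rw [map_measureReal_apply (hξ t) (measurableSet_singleton e), ← hlaw t e]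
      rfl
    rw [← integral_map (hξ t).aemeasurable (f := Draw.cost τ)
      (measurable_of_countable _).aestronglyMeasurable, integral_fintype Integrable.of_finite,
      Draw.sum_eq]
    simp only [hreal, smul_eq_mul, Draw.cost, mul_one, sum_drawProb_comp hP hκ]
    rfl
  rw [integral_finsetSum _ fun t _ => hint t]
  simp only [hone, Finset.sum_const, Finset.card_range, nsmul_eq_mul]

end Draws

/-! ### The expected time to reach a given precision -/

/-- At the largest step size, the rate is at least half the inverse of
`κ_comm / γ + m + κ_s`. -/
theorem inv_le_commConvex_mul_stepSize (hP : P.Admissible) (hκ : P.IsStochasticCondition κs) :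
    1 ≤ 2 * (P.kappaComm / P.gap + (m + κs)) * (P.commConvex * P.stepSize κs) := by
  have hcs := hP.commSmooth_pos
  have hcc := hP.commConvex_pos
  have hmk := add_kappa_pos hP hκ
  rw [hP.kappaComm_div_gap]
  have hp : P.pComm κs = P.commSmooth / P.commConvex / (P.commSmooth / P.commConvex + (m + κs)) := by
    rw [pComm_eq hP]
    field_simp
  set R := P.commSmooth / P.commConvex with hR
  have hR0 : 0 < R := div_pos hcs hcc
  rcases stepSize_eq (κs := κs) hP with h | ⟨i, j, h⟩
  · have h1 : P.commConvex * P.stepSize κs = 1 / (R + (m + κs)) := by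
      rw [h, hp, hR]
      field_simp
    rw [h1]
    field_simp
    norm_num
  · have hone := one_add_div_pos hP i j
    have hS := sum_one_add_div_pos hP i
    have h1 : P.commConvex * P.stepSize κs =
        1 / 2 * ((m + κs) / (R + (m + κs)) / ∑ k, (1 + P.L i k / P.σ i)) := by
      have h2 : 1 - P.pComm κs = (m + κs) / (R + (m + κs)) := by
        rw [hp]; field_simp; ring
      rw [h, pComp, h2, alpha]
      field_simp
    have h3 : ∑ k, (1 + P.L i k / P.σ i) ≤ m + κs := by
      rw [Finset.sum_add_distrib]
      have := hκ.le hP i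
      simpa using this
    rw [h1]
    calc (1 : ℝ) ≤ (m + κs) / ∑ k, (1 + P.L i k / P.σ i) := (one_le_div hS).mpr h3
      _ = _ := by field_simp

/-- The number of iterations that a linear rate `1 - ρ` needs for a precision `ε`. -/
theorem exists_iterations {ρ ℓ ε : ℝ} (hρ0 : 0 < ρ) (hρ1 : ρ < 1) (hℓ : 0 ≤ ℓ) (hε : 0 < ε)
    (hε1 : ε ≤ Real.exp (-1) / (1 + ℓ)) :
    ∃ K : ℕ, (∀ t, K ≤ t → (1 - ρ) ^ t * ℓ ≤ ε) ∧ K * ρ ≤ 2 * Real.log ε⁻¹ := by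
  have hℓ1 : 0 < 1 + ℓ := by linarith
  have hlog : Real.log (1 + ℓ) + 1 ≤ Real.log ε⁻¹ := by
    have h1 := Real.log_le_log hε hε1
    rw [Real.log_div (Real.exp_pos _).ne' hℓ1.ne', Real.log_exp] at h1
    rw [Real.log_inv]
    linarith
  have hlog0 : 0 ≤ Real.log (1 + ℓ) := Real.log_nonneg (by linarith)
  set X := Real.log (1 + ℓ) + Real.log ε⁻¹ with hX
  have hX0 : 0 ≤ X / ρ := div_nonneg (by linarith) hρ0.le
  refine ⟨⌈X / ρ⌉₊, fun t ht => ?_, ?_⟩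
  · have h1 : X ≤ ρ * t := by
      have := (div_le_iff₀ hρ0).mp ((Nat.le_ceil _).trans (Nat.cast_le.mpr ht))
      linarith
    calc (1 - ρ) ^ t * ℓ ≤ Real.exp (-ρ) ^ t * (1 + ℓ) := by
          refine mul_le_mul (pow_le_pow_left₀ (by linarith) ?_ t) (by linarith) hℓ (by positivity)
          linarith [Real.add_one_le_exp (-ρ)]
      _ = Real.exp (-(ρ * t) + Real.log (1 + ℓ)) := by
          rw [← Real.exp_nat_mul, Real.exp_add, Real.exp_log hℓ1]
          congr 2
          ring
      _ ≤ Real.exp (Real.log ε) := by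
          refine Real.exp_le_exp.mpr ?_
          rw [hX, Real.log_inv] at h1
          linarith
      _ = ε := Real.exp_log hε
  · have h1 := (Nat.ceil_lt_add_one hX0).le
    have h2 := mul_le_mul_of_nonneg_right h1 hρ0.le
    rw [add_mul, div_mul_cancel₀ _ hρ0.ne'] at h2
    linarith

end Problem

end DVR

theorem mainTheorem4 {n m d : ℕ} (hn : 2 ≤ n) (hm : 1 ≤ m) (P : DVR.Problem n m d)
    -- the regularizations, the graph and the weights of the communication edges
    (hσ : ∀ i, 0 < P.σ i) (hG : P.G.Connected) (hw : ∀ e, P.w e ≠ 0)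
    -- every `f i j` is convex and `L i j`-smooth
    (hL : ∀ i j, 0 < P.L i j)
    (hconv : ∀ i j, ConvexOn ℝ Set.univ (P.f i j))
    (hdiff : ∀ i j, Differentiable ℝ (P.f i j))
    (hsmooth : ∀ i j u v,
      ‖gradient (P.f i j) u - gradient (P.f i j) v‖ ≤ P.L i j * ‖u - v‖)
    -- the stochastic condition number, in either of the two normalizations in use
    (κs : ℝ)
    (hκs : κs = (⨆ i, (1 + ∑ j, P.L i j) / P.σ i) ∨ κs = ⨆ i, (1 + (∑ j, P.L i j) / P.σ i))
    -- a dual optimum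
    (lamStar : P.DualVar) (hstar : ∀ lam, P.dualObj lam ≤ P.dualObj lamStar) :
    0 < P.stepSize κs ∧ ∀ η : ℝ, 0 < η → η ≤ P.stepSize κs →
      -- the contraction factor is a genuine one
      (0 < 1 - P.alpha * η / 2 ∧ 1 - P.alpha * η / 2 < 1) ∧
      -- the Lyapunov quantity involves only finite values and a (sub)gradient of `φ`
      ((∃ r : ℝ, P.dualObj lamStar = r) ∧ (∃ r : ℝ, P.phi lamStar = r) ∧
        ∀ s : P.State, (∃ r : ℝ, P.dualObj s.lam = r) ∧ (∃ r : ℝ, P.phi s.lam = r) ∧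
          ∀ lam, P.phi s.lam + ((inner ℝ s.gradPhi (lam - s.lam) : ℝ) : EReal) ≤ P.phi lam) ∧
      -- contraction in (conditional) expectation at each step
      (∀ s : P.State, (∀ i, s.θ i = (P.σ i)⁻¹ • P.augA s.lam (Sum.inl i)) →
        ∑ e, P.drawProb κs e * P.lyapunov κs η lamStar (P.step κs η s e) ≤
          (1 - P.alpha * η / 2) * P.lyapunov κs η lamStar s) ∧
      -- the process driven by independent samples
      ∀ {Ω : Type*} [MeasurableSpace Ω] (μ : MeasureTheory.Measure Ω)
        [MeasureTheory.IsProbabilityMeasure μ] (ξ : ℕ → Ω → DVR.Draw n m),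
        (∀ t, Measurable (ξ t)) → ProbabilityTheory.iIndepFun ξ μ →
        (∀ t e, μ.real {ω | ξ t ω = e} = P.drawProb κs e) →
        ∀ (x₀ : DVR.Edge P.G → DVR.Vec d) (z₀ : Fin n → Fin m → DVR.Vec d),
          -- `λ_t` and `θ_t` correspond to each other
          (∀ t ω i, (P.run κs η (P.init x₀ z₀) (fun s => ξ s ω) t).θ i =
            (P.σ i)⁻¹ • P.augA (P.run κs η (P.init x₀ z₀) (fun s => ξ s ω) t).lam (Sum.inl i)) ∧
          -- linear convergence in expectation
          (∀ t, MeasureTheory.Integrable (fun ω => P.lyapunov κs η lamStar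
              (P.run κs η (P.init x₀ z₀) (fun s => ξ s ω) t)) μ ∧
            ∫ ω, P.lyapunov κs η lamStar (P.run κs η (P.init x₀ z₀) (fun s => ξ s ω) t) ∂μ ≤
              (1 - P.alpha * η / 2) ^ t * P.lyapunov κs η lamStar (P.init x₀ z₀)) ∧
          -- expected time to reach precision `ε`
          (η = P.stepSize κs → ∀ τ : ℝ, 0 ≤ τ → ∀ ε : ℝ, 0 < ε →
            ε ≤ Real.exp (-1) / (1 + P.lyapunov κs η lamStar (P.init x₀ z₀)) →
            ∃ K : ℕ,
              (∀ t, K ≤ t → ∫ ω, P.lyapunov κs η lamStar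
                (P.run κs η (P.init x₀ z₀) (fun s => ξ s ω) t) ∂μ ≤ ε) ∧
              ∫ ω, ∑ t ∈ Finset.range K, (ξ t ω).cost τ ∂μ ≤
                4 * (2 * (m + κs) + τ * P.kappaComm / P.gap) * Real.log ε⁻¹) := by
  have hP : P.Admissible := ⟨hn, hm, hσ, hG, hw, hL, hconv, hdiff, hsmooth⟩
  have hκ : P.IsStochasticCondition κs := hκs
  refine ⟨DVR.Problem.stepSize_pos hP hκ, fun η hη0 hη => ?_⟩
  have hfac := DVR.Problem.contraction_factor_mem hP hκ hη0 hη
  obtain ⟨c, hc⟩ := DVR.Problem.exists_fenchel_eq_coe hP hstar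
  refine ⟨hfac, ⟨⟨_, DVR.Problem.dualObj_eq_coe hc⟩, ⟨_, DVR.Problem.phi_eq_coe hP hc⟩, fun s =>
    ⟨⟨_, DVR.Problem.dualObj_eq_coe (DVR.Problem.fenchel_lam hP s)⟩,
      ⟨_, DVR.Problem.phi_eq_coe hP (DVR.Problem.fenchel_lam hP s)⟩,
      DVR.Problem.phi_add_inner_le hP s⟩⟩,
    fun s hs => DVR.Problem.sum_drawProb_mul_lyapunov_le hP hκ hη0 hη hstar hs, ?_⟩
  intro Ω _ μ _ ξ hξ hind hlaw x₀ z₀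
  have hs := DVR.Problem.State.Consistent.init (P := P) x₀ z₀
  have hrate := fun t => DVR.Problem.integral_lyapunov_run_le hP hκ hη0 hη hstar hξ hind hlaw hs t
  refine ⟨fun t ω => hs.run hP _ t, fun t =>
    ⟨DVR.Problem.integrable_lyapunov_run hξ _ t, hrate t⟩, ?_⟩
  intro hηeq τ hτ ε hε hε1
  obtain ⟨K, hK, hKρ⟩ := DVR.Problem.exists_iterations (ρ := P.alpha * η / 2) (by linarith)
    (by linarith) (DVR.Problem.lyapunov_nonneg hP hκ hη0 hstar (P.init x₀ z₀)) hε hε1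
  refine ⟨K, fun t ht => (hrate t).trans (hK t ht), ?_⟩
  rw [DVR.Problem.integral_sum_cost hP hκ hξ hlaw]
  have hρ : P.alpha * η / 2 = P.commConvex * P.stepSize κs := by
    rw [DVR.Problem.alpha, hηeq]; ring
  rw [hρ] at hKρ
  have hinv := DVR.Problem.inv_le_commConvex_mul_stepSize hP hκ
  have hmk := DVR.Problem.add_kappa_pos hP hκ
  have hcs := hP.commSmooth_pos
  have hcc := hP.commConvex_pos
  -- the expected duration of an iteration is at most `(τ R + m + κ_s) / (R + m + κ_s)`
  have hcost : (P.pComm κs * τ + (1 - P.pComm κs)) * (P.kappaComm / P.gap + (m + κs)) =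
      τ * (P.kappaComm / P.gap) + (m + κs) := by
    rw [DVR.Problem.pComm_eq hP, hP.kappaComm_div_gap]
    field_simp
    ring
  set R := P.kappaComm / P.gap with hR
  have hR0 : 0 ≤ R := by rw [hR, hP.kappaComm_div_gap]; positivity
  set q := P.pComm κs * τ + (1 - P.pComm κs)
  set ρ := P.commConvex * P.stepSize κs
  have hq0 : 0 ≤ q := add_nonneg (mul_nonneg (DVR.Problem.pComm_pos hP hκ).le hτ)
    (sub_nonneg.mpr (DVR.Problem.pComm_lt_one hP hκ).le)
  have hlog : 0 ≤ Real.log ε⁻¹ := by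
    have : 0 ≤ K * ρ := mul_nonneg (Nat.cast_nonneg K)
      (mul_pos hcc (DVR.Problem.stepSize_pos hP hκ)).le
    linarith
  rw [mul_div_assoc, ← hR]
  calc K * q = K * q * 1 := (mul_one _).symm
    _ ≤ K * q * (2 * (R + (m + κs)) * ρ) :=
      mul_le_mul_of_nonneg_left hinv (mul_nonneg (Nat.cast_nonneg K) hq0)
    _ = 2 * (q * (R + (m + κs))) * (K * ρ) := by ring
    _ ≤ 2 * (q * (R + (m + κs))) * (2 * Real.log ε⁻¹) := by
      refine mul_le_mul_of_nonneg_left hKρ ?_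
      positivity
    _ = 4 * (τ * R + (m + κs)) * Real.log ε⁻¹ := by rw [hcost]; ring
    _ ≤ 4 * (2 * (m + κs) + τ * R) * Real.log ε⁻¹ := by
      refine mul_le_mul_of_nonneg_right ?_ hlog
      linarith
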